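/- **Proposition.** Throughout, graded rings are commutative and $\mathbb{N}$-graded, and $\mathsf{GrRing}$ is their category (degree-preserving ring homomorphisms). For a scheme $X$ let $K(X)$ be the Grothendieck group of finite rank locally free sheaves on $X$ (generators $[\mathcal F]$, relations $[\mathcal G]=[\mathcal E]+[\mathcal F]$ for short exact sequences $0\to\mathcal E\to\mathcal G\to\mathcal F\to 0$), a contravariant functor of $X$ via pullback. The rank of a locally free sheaf is a locally constant function; for an integer $i>0$, "$i>\mathrm{rk}(\mathcal F)$" means that $i$ is greater than the rank of $\mathcal F$ at every point of $X$. A *projective bundle* over $X$ is $\mathbb P(\mathcal E)\to X$ (parametrizing invertible quotients of $\mathcal E$) for a finite rank locally free sheaf $\mathcal E$ whose rank is positive at every point. A *chain of projective bundles* $P\to X$ is a finite (possibly empty) composition $P=P_n\to\cdots\to P_1\to P_0=X$ in which each $P_{k+1}\to P_k$ is a projective bundle. *The functor $B$.* For a scheme $X$ let $\mathbb Z[R_X]$ be the polynomial ring on symbols $c_i(\mathcal F)$ of degree $i$, one for each $i\ge 0$ and each finite rank locally free sheaf $\mathcal F$ on $X$, and let $I_X\subset\mathbb Z[R_X]$ be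 the homogeneous ideal generated by - $c_0(\mathcal F)-1$ for all $\mathcal F$; - $c_i(\mathcal F)$ for all $i>\mathrm{rk}(\mathcal F)$; - $c_i(\mathcal G)-\sum_{j=0}^i c_{i-j}(\mathcal F)\,c_j(\mathcal E)$ for all $i\ge 0$ and all short exact sequences $0\to\mathcal E\to\mathcal G\to\mathcal F\to0$; - $c_1(\mathcal L\otimes\mathcal L')-c_1(\mathcal L)-c_1(\mathcal L')$ for all invertible $\mathcal L,\mathcal L'$. For $f:X\to Y$ there is a ring homomorphism $f^*:\mathbb Z[R_Y]\to\mathbb Z[R_X]$, $c_i(\mathcal F)\mapsto c_i(f^*\mathcal F)$, with $f^*I_Y\subset I_X$. Let $J_X$ be the homogeneous ideal of those $x\in\mathbb Z[R_X]$ for which $p^*x\in I_P$ for some chain of projective bundles $p:P\to X$, i.e. the kernel of the map from $\mathbb Z[R_X]$ to the direct limit of the rings $\mathbb Z[R_P]/I_P$. Put $B(X)=\mathbb Z[R_X]/J_X$ with the induced grading and the induced pullbacks $f^*$; this is a contravariant functor $B:\mathsf{Sch}\to\mathsf{GrRing}$. Let $c_i^B:K\to B^i$ be the natural transformation (of functors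 to sets) for which $c_i^B(x)$ is the coefficient of $t^i$ of $c_t^B(x)$, where $c_t^B:K(X)\to 1+tB(X)[[t]]$ is the group homomorphism from the additive group $K(X)$ to the multiplicative group determined by $c_t^B([\mathcal F])=1+[c_1(\mathcal F)]t+[c_2(\mathcal F)]t^2+\cdots$ for every finite rank locally free sheaf $\mathcal F$. *Universal property.* Let $A:\mathsf{Sch}\to\mathsf{GrRing}$ be any contravariant functor, and for every integer $i\ge0$ let $c_i^A:K\to A^i$ be a natural transformation of functors from schemes to sets. Write $c_i^A(\mathcal F)=c_i^A([\mathcal F])$ and suppose that: 1. $c_0^A(\mathcal F)=1$ for every finite rank locally free sheaf $\mathcal F$ on a scheme $X$; 2. $c_i^A(\mathcal F)=0$ for every integer $i>\mathrm{rk}(\mathcal F)$; 3. $c_i^A(\mathcal G)=\sum_{j=0}^i c_{i-j}^A(\mathcal F)\,c_j^A(\mathcal E)$ for every $i\ge 0$ and every short exact sequence $0\to\mathcal E\to\mathcal G\to\mathcal F\to0$ of finite rank locally free sheaves; 4. $c_1^A(\mathcal L\otimes\mathcal L')=c_1^A(\mathcal L)+c_1^A(\mathcal L')$ for all invertible sheaves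 $\mathcal L,\mathcal L'$ on a scheme $X$; 5. for every projective bundle $P=\mathbb P(\mathcal E)\to X$ the pullback $A(X)\to A(P)$ is injective. Then there is exactly one natural transformation $b_A:B\to A$ of functors from schemes to graded rings such that $b_A(c_i^B([\mathcal F]))=c_i^A([\mathcal F])$ for every scheme $X$, every $i\ge0$ and every finite rank locally free sheaf $\mathcal F$ on $X$. -/

import Mathlib

universe u w w'

open CategoryTheory AlgebraicGeometry

namespace ChernUniversal

noncomputable section

open TopologicalSpace
open AlgebraicGeometry.Scheme.Modules

variable {X Y Z : Scheme.{u}}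

attribute [local instance] Abelian.hasFiniteBiproducts

/-! Sections of sheaves of modules, and sheafification. -/

lemma restrictFunctor_isRightAdjoint (f : X ⟶ Y) [IsOpenImmersion f] :
    (restrictFunctor f).IsRightAdjoint := by
  unfold restrictFunctor
  refine @SheafOfModules.instIsRightAdjointPushforward _ _ _ _ _ _ _ _ _ _ _ ?_ ?_ ?_
  · exact PresheafOfModules.instIsRightAdjointPushforward _
  all_goals infer_instance

lemma final_opensMap (f : X ⟶ Y) : (Opens.map f.base).Final := by
  constructor
  intro U
  have : Nonempty (StructuredArrow U (Opens.map f.base)) :=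
    ⟨StructuredArrow.mk (Y := (⊤ : Opens Y)) (homOfLE le_top)⟩
  have h : ∀ a : StructuredArrow U (Opens.map f.base),
      Nonempty (a ⟶ StructuredArrow.mk (Y := (⊤ : Opens Y)) (homOfLE le_top)) :=
    fun a => ⟨StructuredArrow.homMk (homOfLE le_top) (Subsingleton.elim _ _)⟩
  apply zigzag_isConnected
  intro a b
  exact (Zigzag.of_hom (h a).some).trans (Zigzag.of_inv (h b).some)

/-- The structure sheaf of `X` as a module over itself. -/
abbrev structureSheaf (X : Scheme.{u}) : X.Modules := SheafOfModules.unit X.ringCatSheaf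

instance pushforward_isRightAdjoint (f : X ⟶ Y) :
    (SheafOfModules.pushforward.{u} f.toRingCatSheafHom).IsRightAdjoint :=
  inferInstanceAs (pushforward f).IsRightAdjoint

lemma isIso_pullbackObjUnitToUnit (f : X ⟶ Y) :
    IsIso (SheafOfModules.pullbackObjUnitToUnit.{u} f.toRingCatSheafHom) := by
  have := final_opensMap f
  exact SheafOfModules.instIsIsoPullbackObjUnitToUnitOfFinal _

def pullbackUnitIso (f : X ⟶ Y) :
    (pullback f).obj (structureSheaf Y) ≅ structureSheaf X :=
  let e := @asIso (SheafOfModules.{u} X.ringCatSheaf) _ _ _ _ (isIso_pullbackObjUnitToUnit f)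
  ⟨e.hom, e.inv, e.hom_inv_id, e.inv_hom_id⟩

lemma mono_iff {M N : X.Modules} (φ : M ⟶ N) :
    Mono φ ↔ ∀ U : X.Opens, Function.Injective (φ.app U) := by
  constructor
  · intro h U
    have h1 : Mono ((toPresheaf X).map φ) := inferInstance
    have h2 : Mono (((toPresheaf X).map φ).app (.op U)) := inferInstance
    exact (AddCommGrpCat.mono_iff_injective _).1 h2
  · intro h
    have h1 : Mono ((toPresheaf X).map φ) := by
      rw [NatTrans.mono_iff_mono_app]
      intro U
      exact (AddCommGrpCat.mono_iff_injective _).2 (h U.unop)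
    exact (toPresheaf X).mono_of_mono_map h1

/-- Restriction of sections. -/
abbrev res (M : X.Modules) {U V : X.Opens} (h : V ≤ U) (s : Γ(M, U)) : Γ(M, V) :=
  M.presheaf.map (homOfLE h).op s

lemma res_res (M : X.Modules) {U V W : X.Opens} (h : V ≤ U) (h' : W ≤ V) (s : Γ(M, U)) :
    res M h' (res M h s) = res M (h'.trans h) s := by
  have : M.presheaf.map (homOfLE (h'.trans h)).op =
    M.presheaf.map (homOfLE h).op ≫ M.presheaf.map (homOfLE h').op := by
    rw [← Functor.map_comp]; rfl
  rw [res, res, res, this]; rfl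

lemma res_self (M : X.Modules) {U : X.Opens} (s : Γ(M, U)) : res M le_rfl s = s := by
  have : M.presheaf.map (homOfLE (le_refl U)).op = 𝟙 _ := M.presheaf.map_id _
  rw [res, this]; rfl

lemma app_res {M N : X.Modules} (φ : M ⟶ N) {U V : X.Opens} (h : V ≤ U) (s : Γ(M, U)) :
    φ.app V (res M h s) = res N h (φ.app U s) :=
  ConcreteCategory.congr_hom (φ.mapPresheaf.naturality (homOfLE h).op) s

lemma eq_of_locally_eq (M : X.Modules) {U : X.Opens} (s t : Γ(M, U))
    (h : ∀ x ∈ U, ∃ V : X.Opens, x ∈ V ∧ ∃ hV : V ≤ U, res M hV s = res M hV t) : s = t := by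
  choose V hx hV e using h
  refine TopCat.Sheaf.eq_of_locally_eq' ⟨M.presheaf, M.isSheaf⟩ (fun x : U => V x.1 x.2) U
    (fun x => homOfLE (hV x.1 x.2)) ?_ s t ?_
  · intro x hxU
    simp only [Opens.mem_iSup]
    exact ⟨⟨x, hxU⟩, hx x hxU⟩
  · intro i
    exact e i.1 i.2

lemma exists_eq_image (U V : X.Opens) (h : V ≤ U) :
    ∃ W : (U : Scheme.{u}).Opens, V = U.ι ''ᵁ W := by
  refine ⟨U.ι ⁻¹ᵁ V, ?_⟩
  rw [Scheme.Hom.image_preimage_eq_opensRange_inf, Scheme.Opens.opensRange_ι]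
  exact (inf_eq_right.2 h).symm

/-- The sheaf of modules associated with a presheaf of modules. -/
def sheafify (P : X.PresheafOfModules) : X.Modules :=
  (PresheafOfModules.sheafification.{u} (𝟙 X.ringCatSheaf.obj)).obj P

def toSheafify (P : X.PresheafOfModules) : P ⟶ (sheafify P).val :=
  (PresheafOfModules.sheafificationAdjunction.{u} (𝟙 X.ringCatSheaf.obj)).unit.app P

lemma toSheafify_locally_injective (P : X.PresheafOfModules) {U : X.Opens}
    (s : P.obj (.op U)) (hs : (toSheafify P).app (.op U) s = 0) (x : X) (hx : x ∈ U) :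
    ∃ V : X.Opens, x ∈ V ∧ ∃ hV : V ≤ U, P.map (homOfLE hV).op s = 0 := by
  have h := CategoryTheory.Presheaf.isLocallyInjective_toSheafify' (Opens.grothendieckTopology X) P.presheaf
  have := h.equalizerSieve_mem (X := .op U) s 0 (by
    rw [map_zero]; exact hs)
  obtain ⟨V, f, hf, hxV⟩ := this x hx
  exact ⟨V, hxV, f.le, hf.trans (map_zero _)⟩

lemma toSheafify_locally_surjective (P : X.PresheafOfModules) {U : X.Opens}
    (t : Γ(sheafify P, U)) (x : X) (hx : x ∈ U) :
    ∃ V : X.Opens, x ∈ V ∧ ∃ hV : V ≤ U, ∃ s : P.obj (.op V),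
      (toSheafify P).app (.op V) s = res (sheafify P) hV t := by
  have h := CategoryTheory.Presheaf.isLocallySurjective_toSheafify' (Opens.grothendieckTopology X) P.presheaf
  obtain ⟨V, f, ⟨s, hs⟩, hxV⟩ := h.imageSieve_mem (U := U) t x hx
  exact ⟨V, hxV, f.le, s, hs⟩

lemma exists_local_lift {M N : X.Modules} (φ : M ⟶ N) [Epi φ] {U : X.Opens} (s : Γ(N, U))
    (x : X) (hx : x ∈ U) :
    ∃ V : X.Opens, x ∈ V ∧ ∃ hV : V ≤ U, ∃ t : Γ(M, V), φ.app V t = res N hV s := by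
  let P : X.PresheafOfModules := Limits.cokernel φ.val
  let π : N.val ⟶ P := Limits.cokernel.π φ.val
  have h0 : π ≫ toSheafify P = 0 := by
    let ψ : N ⟶ sheafify P := SheafOfModules.Hom.mk (π ≫ toSheafify P)
    have h1 : φ ≫ ψ = 0 := by
      apply SheafOfModules.hom_ext
      change φ.val ≫ π ≫ toSheafify P = 0
      rw [← Category.assoc, Limits.cokernel.condition, Limits.zero_comp]
    have h2 : ψ = 0 := (cancel_epi φ).1 (by rw [h1, Limits.comp_zero])
    exact congrArg (fun a => SheafOfModules.Hom.val a) h2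
  obtain ⟨V, hxV, hV, e⟩ := toSheafify_locally_injective P (π.app (.op U) s)
    (congrArg (fun a : N.val ⟶ _ => a.app (.op U) s) h0) x hx
  refine ⟨V, hxV, hV, ?_⟩
  have e' : π.app (.op V) (res N hV s) = 0 := by
    exact (PresheafOfModules.naturality_apply π (homOfLE hV).op s).trans e
  have ex : (ShortComplex.mk φ.val π (Limits.cokernel.condition _)).Exact :=
    ShortComplex.exact_cokernel _
  have ex2 := ex.map (PresheafOfModules.evaluation.{u} X.ringCatSheaf.obj (.op V))
  rw [ShortComplex.moduleCat_exact_iff] at ex2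
  exact ex2 _ e'

/-! Locally free sheaves and their pullbacks. -/

/-- The free module `𝒪_X ^ n`. -/
def freeModule (X : Scheme.{u}) (n : ℕ) : X.Modules :=
  Limits.biproduct fun _ : Fin n ↦ structureSheaf X

/-- `F` is free of rank `n` in a neighbourhood of `x`. -/
def HasRankAt (F : X.Modules) (x : X) (n : ℕ) : Prop :=
  ∃ U : X.Opens, x ∈ U ∧ Nonempty (F.restrict U.ι ≅ freeModule (U : Scheme.{u}) n)

/-- `F` is locally free of finite rank. -/
def IsLocallyFree (F : X.Modules) : Prop := ∀ x : X, ∃ n : ℕ, HasRankAt F x n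

/-- `L` is an invertible sheaf, that is, it is locally free of rank `1`. -/
def IsInvertible (L : X.Modules) : Prop := ∀ x : X, HasRankAt L x 1

def freeι (X : Scheme.{u}) {n : ℕ} (i : Fin n) : structureSheaf X ⟶ freeModule X n :=
  Limits.biproduct.ι (fun _ : Fin n ↦ structureSheaf X) i

def freeDesc {n : ℕ} {M : X.Modules} (s : Fin n → (structureSheaf X ⟶ M)) : freeModule X n ⟶ M :=
  Limits.biproduct.desc s

@[simp] lemma freeι_desc {n : ℕ} {M : X.Modules} (s : Fin n → (structureSheaf X ⟶ M)) (i : Fin n) :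
    freeι X i ≫ freeDesc s = s i := Limits.biproduct.ι_desc _ _

lemma free_hom_ext {n : ℕ} {M : X.Modules} {φ ψ : freeModule X n ⟶ M}
    (h : ∀ i, freeι X i ≫ φ = freeι X i ≫ ψ) : φ = ψ := Limits.biproduct.hom_ext' _ _ h

lemma HasRankAt.of_iso {F G : X.Modules} (e : F ≅ G) {x : X} {n : ℕ} (h : HasRankAt F x n) :
    HasRankAt G x n := by
  obtain ⟨U, hx, ⟨i⟩⟩ := h
  exact ⟨U, hx, ⟨(restrictFunctor U.ι).mapIso e.symm ≪≫ i⟩⟩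

def freePullbackIso (f : X ⟶ Y) (n : ℕ) :
    (pullback f).obj (freeModule Y n) ≅ freeModule X n :=
  (pullback f).mapBiproduct _ ≪≫ Limits.biproduct.mapIso fun _ ↦ pullbackUnitIso f

/-- Base change of pullback functors in a commutative square of schemes. -/
def pullbackSquareIso {X' Y' : Scheme.{u}} {f : X ⟶ Y} {f' : X' ⟶ Y'} {j' : X' ⟶ X} {j : Y' ⟶ Y}
    (w : j' ≫ f = f' ≫ j) : pullback f ⋙ pullback j' ≅ pullback j ⋙ pullback f' :=
  pullbackComp j' f ≪≫ pullbackCongr w ≪≫ (pullbackComp f' j).symm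

lemma HasRankAt.pullback (f : X ⟶ Y) {F : Y.Modules} {x : X} {n : ℕ} (h : HasRankAt F (f x) n) :
    HasRankAt ((pullback f).obj F) x n := by
  obtain ⟨U, hx, ⟨i⟩⟩ := h
  refine ⟨f ⁻¹ᵁ U, hx, ⟨(restrictFunctorIsoPullback _).app _ ≪≫
    (pullbackSquareIso (morphismRestrict_ι f U).symm).app F ≪≫
    (Scheme.Modules.pullback (f ∣_ U)).mapIso ((restrictFunctorIsoPullback _).symm.app F ≪≫ i) ≪≫
    freePullbackIso _ _⟩⟩

lemma mono_of_locally {M N : X.Modules} (φ : M ⟶ N)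
    (h : ∀ x : X, ∃ (W : Scheme.{u}) (j : W ⟶ X) (_ : IsOpenImmersion j),
      x ∈ j.opensRange ∧ Mono ((restrictFunctor j).map φ)) : Mono φ := by
  rw [mono_iff]
  intro U
  rw [injective_iff_map_eq_zero]
  intro s hs
  refine eq_of_locally_eq M s 0 fun x hx => ?_
  obtain ⟨W, j, _, hxV, hV⟩ := h x
  rw [mono_iff] at hV
  refine ⟨U ⊓ j.opensRange, ⟨hx, hxV⟩, inf_le_left, ?_⟩
  have key : ∀ V : X.Opens, V ≤ j.opensRange → ∀ hU : V ≤ U, res M hU s = res M hU 0 := by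
    intro V hW hU
    obtain ⟨V', rfl⟩ : ∃ V', V = j ''ᵁ V' := ⟨j ⁻¹ᵁ V, by
      rw [Scheme.Hom.image_preimage_eq_opensRange_inf]; exact (inf_eq_right.2 hW).symm⟩
    apply hV V'
    change φ.app _ (res M hU s) = φ.app _ (res M hU 0)
    rw [app_res, app_res, hs, map_zero]
  exact key _ inf_le_right _

/-- The morphism `𝒪_X ⟶ M` given by a global section of `M`. -/
def homOfSection (M : X.Modules) (s : Γ(M, ⊤)) : structureSheaf X ⟶ M :=
  (SheafOfModules.unitHomEquiv M).symm
    (PresheafOfModules.sectionsMk (fun U => res M (U := ⊤) le_top s) (fun {U V} f => by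
      exact res_res M (U := ⊤) _ _ s))

lemma homOfSection_app (M : X.Modules) (s : Γ(M, ⊤)) (U : X.Opens) (r : Γ(X, U)) :
    (homOfSection M s).app U r = r • res M le_top s := rfl

lemma unit_hom_app {M : X.Modules} (χ : structureSheaf X ⟶ M) (U : X.Opens) (r : Γ(X, U)) :
    χ.app U r = r • res M le_top (χ.app ⊤ (1 : Γ(X, ⊤))) := by
  have h1 : res (structureSheaf X) (U := ⊤) le_top (1 : Γ(X, ⊤)) = (1 : Γ(X, U)) :=
    map_one (X.presheaf.map (homOfLE (le_top : U ≤ ⊤)).op).hom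
  have h3 : res M le_top (χ.app ⊤ (1 : Γ(X, ⊤))) = χ.app U (1 : Γ(X, U)) :=
    (app_res χ le_top _).symm.trans (congrArg (χ.app U) h1)
  have h2 := Scheme.Modules.Hom.app_smul χ r (show Γ(structureSheaf X, U) from (1 : Γ(X, U)))
  refine Eq.trans ?_ (h2.trans (congrArg (r • ·) h3.symm))
  exact congrArg (χ.app U) (mul_one r).symm

lemma unit_hom_ext {M : X.Modules} {φ ψ : structureSheaf X ⟶ M}
    (h : φ.app ⊤ (1 : Γ(X, ⊤)) = ψ.app ⊤ (1 : Γ(X, ⊤))) : φ = ψ := by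
  ext U r
  exact (unit_hom_app φ U r).trans
    ((congrArg (fun a => (show Γ(X, U) from r) • res M le_top a) h).trans (unit_hom_app ψ U r).symm)

instance restrictFunctor_additive (f : X ⟶ Y) [IsOpenImmersion f] :
    (restrictFunctor f).Additive where
  map_add := rfl

lemma restrict_map_app (f : X ⟶ Y) [IsOpenImmersion f] {M N : Y.Modules} (φ : M ⟶ N)
    (U : X.Opens) : ((restrictFunctor f).map φ).app U = φ.app (f ''ᵁ U) := rfl

def freeRestrictIso (f : X ⟶ Y) [IsOpenImmersion f] (n : ℕ) :
    (freeModule Y n).restrict f ≅ freeModule X n :=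
  (restrictFunctor f).mapBiproduct _ ≪≫ Limits.biproduct.mapIso fun _ ↦ restrictUnitIso f

lemma freeι_restrictIso_inv (f : X ⟶ Y) [IsOpenImmersion f] {n : ℕ} (i : Fin n) :
    freeι X i ≫ (freeRestrictIso f n).inv =
      (restrictUnitIso f).inv ≫ (restrictFunctor f).map (freeι Y i) := by
  have h := Limits.biproduct.ι_map (f := fun _ : Fin n ↦ structureSheaf X)
      (g := fun _ : Fin n ↦ (structureSheaf Y).restrict f) (fun _ ↦ (restrictUnitIso f).inv) i
  have h' : Limits.biproduct.ι (fun _ : Fin n ↦ (structureSheaf Y).restrict f) i ≫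
      ((restrictFunctor f).mapBiproduct fun _ : Fin n ↦ structureSheaf Y).inv =
      (restrictFunctor f).map (freeι Y i) := by
    rw [Functor.mapBiproduct_inv, Limits.biproduct.ι_desc]; rfl
  calc _ = (Limits.biproduct.ι (fun _ : Fin n ↦ structureSheaf X) i ≫
      Limits.biproduct.map (g := fun _ : Fin n ↦ (structureSheaf Y).restrict f)
        (fun _ ↦ (restrictUnitIso f).inv)) ≫
        ((restrictFunctor f).mapBiproduct fun _ : Fin n ↦ structureSheaf Y).inv :=
        (Category.assoc _ _ _).symm
    _ = _ := by rw [h, Category.assoc, h']; rfl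

/-- If `g` is an epimorphism onto a free module, it splits locally. -/
lemma exists_local_section {M : X.Modules} {n : ℕ} (g : M ⟶ freeModule X n) [Epi g] (x : X) :
    ∃ V : X.Opens, x ∈ V ∧ IsSplitEpi ((restrictFunctor V.ι).map g) := by
  let e : Fin n → Γ(freeModule X n, ⊤) := fun i => (freeι X i).app ⊤ (1 : Γ(X, ⊤))
  choose V hxV hV t ht using fun i => exists_local_lift g (e i) x (Opens.mem_top x)
  let W : X.Opens := ⟨⋂ i, (V i : Set X), isOpen_iInter_of_finite fun i => (V i).2⟩
  have hW : ∀ i, W ≤ V i := fun i => Set.iInter_subset _ i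
  have hW' : W.ι ''ᵁ ⊤ = W := by simp
  have hle : ∀ i, W.ι ''ᵁ ⊤ ≤ V i := fun i => hW'.le.trans (hW i)
  refine ⟨W, Set.mem_iInter.2 hxV, ⟨⟨?_⟩⟩⟩
  let s : freeModule W n ⟶ M.restrict W.ι := freeDesc fun i =>
    homOfSection (M.restrict W.ι) (res M (hle i) (t i))
  refine ⟨(freeRestrictIso W.ι n).hom ≫ s, ?_⟩
  rw [Category.assoc, ← Iso.eq_inv_comp, Category.comp_id]
  refine free_hom_ext fun i => ?_
  rw [freeι_restrictIso_inv, ← Category.assoc, freeι_desc]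
  apply unit_hom_ext
  have h1 : (homOfSection (M.restrict W.ι) (res M (hle i) (t i))).app ⊤
      (1 : Γ(W, ⊤)) = res M (hle i) (t i) := by
    refine (homOfSection_app _ _ _ _).trans ((one_smul _ _).trans ?_)
    exact res_self _ _
  have h2 : (restrictUnitIso W.ι).inv.app ⊤ (1 : Γ(W, ⊤)) = (1 : Γ(X, W.ι ''ᵁ ⊤)) :=
    map_one (W.ι.appIso ⊤).inv.hom
  have h3 : res (structureSheaf X) (U := ⊤) le_top (1 : Γ(X, ⊤)) = (1 : Γ(X, W.ι ''ᵁ ⊤)) :=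
    map_one (X.presheaf.map (homOfLE (le_top : W.ι ''ᵁ ⊤ ≤ ⊤)).op).hom
  calc g.app (W.ι ''ᵁ ⊤) ((homOfSection (M.restrict W.ι) (res M (hle i) (t i))).app ⊤
        (1 : Γ(W, ⊤))) = g.app (W.ι ''ᵁ ⊤) (res M (hle i) (t i)) := congrArg _ h1
    _ = res (freeModule X n) le_top (e i) := by rw [app_res, ht, res_res]
    _ = (freeι X i).app (W.ι ''ᵁ ⊤) (1 : Γ(X, W.ι ''ᵁ ⊤)) := by
      exact (app_res (freeι X i) le_top _).symm.trans (congrArg ((freeι X i).app _) h3)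
    _ = _ := congrArg ((freeι X i).app (W.ι ''ᵁ ⊤)) h2.symm

lemma restrict_shortExact (f : X ⟶ Y) [IsOpenImmersion f] {S : ShortComplex Y.Modules}
    (h : S.ShortExact) : (S.map (restrictFunctor f)).ShortExact := by
  have := restrictFunctor_isRightAdjoint f
  have : Limits.PreservesFiniteLimits (restrictFunctor f) := by
    have := (Adjunction.ofIsRightAdjoint (restrictFunctor f)).rightAdjoint_preservesLimits.{0, 0}
    infer_instance
  have : Limits.PreservesFiniteColimits (restrictFunctor f) := by
    have := (Adjunction.ofIsLeftAdjoint (restrictFunctor f)).leftAdjoint_preservesColimits.{0, 0}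
    infer_instance
  exact h.map_of_exact _

lemma isSplitEpi_of_comp_iso {C D : Type*} [Category* C] [Category* D] (F : C ⥤ D) {M N N' : C}
    (g : M ⟶ N) (e : N ≅ N') (h : IsSplitEpi (F.map (g ≫ e.hom))) : IsSplitEpi (F.map g) := by
  obtain ⟨⟨σ⟩⟩ := h
  refine ⟨⟨⟨F.map e.hom ≫ σ.section_, ?_⟩⟩⟩
  have h1 : σ.section_ ≫ F.map g ≫ F.map e.hom = 𝟙 _ := by rw [← F.map_comp]; exact σ.id
  rw [← cancel_mono (F.map e.hom), Category.assoc, Category.assoc, h1]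
  simp

lemma isSplitMono_of_isSplitEpi {C : Type*} [Category* C] [Abelian C] {S : ShortComplex C}
    (h : S.ShortExact) (hg : IsSplitEpi S.g) : IsSplitMono S.f := by
  obtain ⟨⟨σ⟩⟩ := hg
  have := h.mono_f
  let spl := ShortComplex.Splitting.ofExactOfSection _ h.exact σ.section_ σ.id h.mono_f
  exact ⟨⟨spl.r, spl.f_r⟩⟩

/-- Pullback preserves short exact sequences with a locally free quotient. -/
lemma pullback_shortExact (f : X ⟶ Y) {S : ShortComplex Y.Modules} (h : S.ShortExact)
    (hF : IsLocallyFree S.X₃) : (S.map (pullback f)).ShortExact := by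
  have hmono : Mono ((pullback f).map S.f) := by
    refine mono_of_locally _ fun x => ?_
    obtain ⟨n, U, hxU, ⟨e⟩⟩ := hF (f x)
    have h1 := restrict_shortExact U.ι h
    have : Epi ((restrictFunctor U.ι).map S.g) := h1.epi_g
    obtain ⟨V, hxV, hV⟩ := exists_local_section ((restrictFunctor U.ι).map S.g ≫ e.hom) ⟨f x, hxU⟩
    have hs : IsSplitMono ((restrictFunctor V.ι).map ((restrictFunctor U.ι).map S.f)) :=
      isSplitMono_of_isSplitEpi (restrict_shortExact V.ι h1)
        (isSplitEpi_of_comp_iso _ _ e hV)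
    let j : (V : Scheme.{u}) ⟶ Y := V.ι ≫ U.ι
    let α : pullback f ⋙ restrictFunctor (Limits.pullback.fst f j) ≅
        (restrictFunctor U.ι ⋙ restrictFunctor V.ι) ⋙ pullback (Limits.pullback.snd f j) :=
      Functor.isoWhiskerLeft _ (restrictFunctorIsoPullback _) ≪≫
        pullbackSquareIso Limits.pullback.condition ≪≫
        Functor.isoWhiskerRight ((restrictFunctorIsoPullback _).symm ≪≫ restrictFunctorComp _ _) _
    refine ⟨_, Limits.pullback.fst f j, inferInstance, ?_, ?_⟩
    · have hr : (Limits.pullback.fst f j).opensRange = f ⁻¹ᵁ j.opensRange :=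
        Scheme.Hom.opensRange_pullbackFst j f
      rw [hr]
      exact ⟨⟨⟨f x, hxU⟩, hxV⟩, rfl⟩
    · have hm : Mono ((pullback (Limits.pullback.snd f j)).map
          ((restrictFunctor V.ι).map ((restrictFunctor U.ι).map S.f))) := inferInstance
      exact ((MorphismProperty.monomorphisms _).arrow_mk_iso_iff
        (((Functor.mapArrowFunctor _ _).mapIso α).app (Arrow.mk S.f))).2 hm
  have : Limits.PreservesFiniteColimits (pullback f) := by
    have := (pullbackPushforwardAdjunction f).leftAdjoint_preservesColimits.{0, 0}
    infer_instance
  have := h.epi_g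
  have hepi : Epi ((pullback f).map S.g) := inferInstance
  exact { exact := h.exact.map_of_epi_of_preservesCokernel _ ‹_› inferInstance
          mono_f := hmono
          epi_g := hepi }

/-! Tensor products of invertible sheaves. -/

/-- The tensor product over `𝒪_X`: the sheaf associated with `U ↦ L(U) ⊗ L'(U)`. -/
def tensor (L L' : X.Modules) : X.Modules :=
  sheafify (PresheafOfModules.Monoidal.tensorObj (R := X.presheaf) L.val L'.val)

/-- The section `s ⊗ t`. -/
def tmul {L L' : X.Modules} {U : X.Opens} (s : Γ(L, U)) (t : Γ(L', U)) : Γ(tensor L L', U) :=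
  (toSheafify (PresheafOfModules.Monoidal.tensorObj (R := X.presheaf) L.val L'.val)).app (.op U)
    (TensorProduct.tmul Γ(X, U) (M := Γ(L, U)) (N := Γ(L', U)) s t)

lemma res_tmul {L L' : X.Modules} {U V : X.Opens} (h : V ≤ U) (s : Γ(L, U)) (t : Γ(L', U)) :
    res (tensor L L') h (tmul s t) = tmul (res L h s) (res L' h t) :=
  (PresheafOfModules.naturality_apply (toSheafify
    (PresheafOfModules.Monoidal.tensorObj (R := X.presheaf) L.val L'.val)) (homOfLE h).op _).symm

lemma exists_tensor_desc {L L' N : X.Modules} (b : ∀ U : X.Opens, Γ(L, U) → Γ(L', U) → Γ(N, U))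
    (hadd : ∀ U s s' t, b U (s + s') t = b U s t + b U s' t)
    (hadd' : ∀ U s t t', b U s (t + t') = b U s t + b U s t')
    (hsmul : ∀ U (r : Γ(X, U)) s t, b U (r • s) t = r • b U s t)
    (hsmul' : ∀ U (r : Γ(X, U)) s t, b U s (r • t) = r • b U s t)
    (hres : ∀ U V (h : V ≤ U) s t, b V (res L h s) (res L' h t) = res N h (b U s t)) :
    ∃ φ : tensor L L' ⟶ N, ∀ U s t, φ.app U (tmul s t) = b U s t := by
  let P := PresheafOfModules.Monoidal.tensorObj (R := X.presheaf) L.val L'.val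
  let ψ : P ⟶ N.val :=
    { app := fun U => ModuleCat.MonoidalCategory.tensorLift (R := X.presheaf.obj U)
        (M₁ := L.val.obj U) (M₂ := L'.val.obj U) (M₃ := N.val.obj U)
        (b U.unop) (hadd _) (hsmul _) (hadd' _) (hsmul' _)
      naturality := fun {U V} f => by
        refine ModuleCat.MonoidalCategory.tensor_ext (fun s t => ?_)
        exact hres U.unop V.unop f.unop.le s t }
  let φ : tensor L L' ⟶ N :=
    (PresheafOfModules.sheafificationHomEquiv.{u} (𝟙 X.ringCatSheaf.obj)).symm ψ
  have h : toSheafify P ≫ φ.val = ψ :=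
    (PresheafOfModules.sheafificationHomEquiv.{u} (𝟙 X.ringCatSheaf.obj)).apply_symm_apply ψ
  refine ⟨φ, fun U s t => ?_⟩
  exact congrArg (fun a : P ⟶ N.val => a.app (.op U) (TensorProduct.tmul Γ(X, U) (M := Γ(L, U)) (N := Γ(L', U)) s t)) h

lemma tmul_smul_smul {L L' : X.Modules} {U : X.Opens} (a b : Γ(X, U)) (s : Γ(L, U)) (t : Γ(L', U)) :
    tmul (a • s) (b • t) = (a * b) • tmul s t := by
  let P := PresheafOfModules.Monoidal.tensorObj (R := X.presheaf) L.val L'.val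
  have h : TensorProduct.tmul Γ(X, U) (M := Γ(L, U)) (N := Γ(L', U)) (a • s) (b • t) =
    (a * b) • TensorProduct.tmul Γ(X, U) (M := Γ(L, U)) (N := Γ(L', U)) s t :=
    TensorProduct.smul_tmul_smul _ _ _ _
  exact (congrArg ((toSheafify P).app (.op U)) h).trans
    (((toSheafify P).app (.op U)).hom.map_smul _ _)

lemma tmul_add {L L' : X.Modules} {U : X.Opens} (s : Γ(L, U)) (t t' : Γ(L', U)) :
    tmul s (t + t') = tmul s t + tmul s t' := by
  let P := PresheafOfModules.Monoidal.tensorObj (R := X.presheaf) L.val L'.val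
  exact (congrArg ((toSheafify P).app (.op U))
    (TensorProduct.tmul_add (R := Γ(X, U)) (M := Γ(L, U)) (N := Γ(L', U)) s t t')).trans
    (((toSheafify P).app (.op U)).hom.map_add _ _)

lemma add_tmul {L L' : X.Modules} {U : X.Opens} (s s' : Γ(L, U)) (t : Γ(L', U)) :
    tmul (s + s') t = tmul s t + tmul s' t := by
  let P := PresheafOfModules.Monoidal.tensorObj (R := X.presheaf) L.val L'.val
  exact (congrArg ((toSheafify P).app (.op U))
    (TensorProduct.add_tmul (R := Γ(X, U)) (M := Γ(L, U)) (N := Γ(L', U)) s s' t)).trans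
    (((toSheafify P).app (.op U)).hom.map_add _ _)

lemma res_smul (M : X.Modules) {U V : X.Opens} (h : V ≤ U) (r : Γ(X, U)) (m : Γ(M, U)) :
    res M h (r • m) = X.presheaf.map (homOfLE h).op r • res M h m := M.map_smul _ _ _

lemma res_zero (M : X.Modules) {U V : X.Opens} (h : V ≤ U) : res M h (0 : Γ(M, U)) = 0 :=
  map_zero (M.presheaf.map (homOfLE h).op).hom

/-- The section `m` freely generates `M` over `U`. -/
def IsGen {M : X.Modules} {U : X.Opens} (m : Γ(M, U)) : Prop :=
  ∀ (W : X.Opens) (h : W ≤ U), Function.Bijective fun r : Γ(X, W) => r • res M h m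

lemma IsGen.res {M : X.Modules} {U V : X.Opens} {m : Γ(M, U)} (hm : IsGen m) (h : V ≤ U) :
    IsGen (res M h m) := fun W hW => by
  simpa only [res_res] using hm W (hW.trans h)

lemma IsGen.of_smul {M : X.Modules} {U : X.Opens} {m m' : Γ(M, U)} (hm : IsGen m) {r : Γ(X, U)}
    (h : r • m' = m) : IsGen m' := by
  obtain ⟨a, ha⟩ := (hm U le_rfl).2 m'
  have ha' : a • m = m' := by simpa only [res_self] using ha
  have hra : r * a = 1 := by
    apply (hm U le_rfl).1
    simp only [res_self, one_smul, mul_smul, ha', h]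
  intro W hW
  have hu : IsUnit (X.presheaf.map (homOfLE hW).op a) :=
    (IsUnit.of_mul_eq_one_right r hra).map (X.presheaf.map (homOfLE hW).op).hom
  have e : (fun t : Γ(X, W) => t • ChernUniversal.res M hW m') =
      (fun t : Γ(X, W) => t • ChernUniversal.res M hW m) ∘ fun t => t * X.presheaf.map (homOfLE hW).op a := by
    funext t
    simp only [Function.comp, ← ha', res_smul, mul_smul]
  rw [e]
  exact (hm W hW).comp (IsUnit.isUnit_iff_mulRight_bijective.1 hu)

lemma epi_of_locally_surjective {M N : X.Modules} (φ : M ⟶ N)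
    (h : ∀ (U : X.Opens) (n : Γ(N, U)) (x : X), x ∈ U →
      ∃ V : X.Opens, x ∈ V ∧ ∃ hV : V ≤ U, ∃ m : Γ(M, V), φ.app V m = res N hV n) : Epi φ := by
  refine ⟨fun {K} α β hαβ => ?_⟩
  ext U n
  refine eq_of_locally_eq K _ _ fun x hx => ?_
  obtain ⟨V, hxV, hV, m, hm⟩ := h U n x hx
  refine ⟨V, hxV, hV, ?_⟩
  have h1 := app_res α hV n
  have h2 := app_res β hV n
  rw [← hm] at h1 h2
  exact h1.symm.trans ((congrArg (fun γ : M ⟶ K => γ.app V m) hαβ).trans h2)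

lemma isIso_of_isGen {M N : X.Modules} (φ : M ⟶ N)
    (h : ∀ x : X, ∃ U : X.Opens, x ∈ U ∧ ∃ m : Γ(M, U), IsGen m ∧ IsGen (φ.app U m)) : IsIso φ := by
  have h1 : Mono φ := by
    rw [mono_iff]
    intro U
    rw [injective_iff_map_eq_zero]
    intro s hs
    refine eq_of_locally_eq M s 0 fun x hx => ?_
    obtain ⟨V, hxV, m, hm, hm'⟩ := h x
    refine ⟨U ⊓ V, ⟨hx, hxV⟩, inf_le_left, ?_⟩
    obtain ⟨r, hr⟩ := (hm _ inf_le_right).2 (res M (inf_le_left : U ⊓ V ≤ U) s)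
    have h0 : φ.app _ (res M (inf_le_left : U ⊓ V ≤ U) s) = 0 := by rw [app_res, hs, res_zero]
    have hr0 : r = 0 := by
      apply (hm' _ inf_le_right).1
      simp only at hr
      rw [← hr, Scheme.Modules.Hom.app_smul, app_res] at h0
      simp only [h0, zero_smul]
    rw [res_zero, ← hr]
    simp only [hr0, zero_smul]
  have h2 : Epi φ := by
    refine epi_of_locally_surjective φ fun U n x hx => ?_
    obtain ⟨V, hxV, m, hm, hm'⟩ := h x
    refine ⟨U ⊓ V, ⟨hx, hxV⟩, inf_le_left, ?_⟩
    obtain ⟨r, hr⟩ := (hm' _ inf_le_right).2 (res N (inf_le_left : U ⊓ V ≤ U) n)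
    refine ⟨r • res M inf_le_right m, ?_⟩
    rw [Scheme.Modules.Hom.app_smul, app_res]
    exact hr
  exact isIso_of_mono_of_epi φ

lemma app_bijective {M N : X.Modules} (φ : M ⟶ N) [IsIso φ] (U : X.Opens) :
    Function.Bijective (φ.app U) :=
  (ConcreteCategory.isIso_iff_bijective (φ.app U)).1 inferInstance

def freeOneIso (X : Scheme.{u}) : freeModule X 1 ≅ structureSheaf X :=
  Limits.biproductUniqueIso _

lemma homOfSection_restrict_app {M : X.Modules} {U : X.Opens} (m : Γ(M, U)) (h : U.ι ''ᵁ ⊤ ≤ U)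
    (W : (U : Scheme.{u}).Opens) (hW : U.ι ''ᵁ W ≤ U) (r : Γ(X, U.ι ''ᵁ W)) :
      (homOfSection (M.restrict U.ι) (res M h m)).app W r = r • res M hW m := by
    refine (homOfSection_app _ _ _ _).trans ?_
    have h1 : U.ι ''ᵁ W ≤ U.ι ''ᵁ ⊤ := Scheme.Hom.image_mono _ le_top
    have h2 : (U.ι.appIso W).inv r = r := by rw [Scheme.Opens.ι_appIso]; rfl
    have h3 : res M h1 (res M h m) = res M hW m := res_res _ _ _ _
    have h4 : ∀ a b : Γ(M, U.ι ''ᵁ W), a = b → ((U.ι.appIso W).inv r) • a = r • b := by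
      rintro a _ rfl
      exact congrArg (· • a) h2
    exact h4 _ _ h3

/-- Transport of generators along restriction to an open subscheme. -/
lemma isGen_iff_isIso {M : X.Modules} {U : X.Opens} (m : Γ(M, U)) (h : U.ι ''ᵁ ⊤ ≤ U) :
    IsGen m ↔ IsIso (homOfSection (M.restrict U.ι) (res M h m)) := by
  have key := homOfSection_restrict_app m h
  rw [Scheme.Modules.Hom.isIso_iff_isIso_app]
  constructor
  · intro hm W
    rw [ConcreteCategory.isIso_iff_bijective]
    have hW : U.ι ''ᵁ W ≤ U := by simpa using U.ι.image_le_opensRange W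
    exact ⟨fun a b hab => (hm _ hW).1 ((key W hW a).symm.trans (hab.trans (key W hW b))),
      fun b => let ⟨r, hr⟩ := (hm _ hW).2 b; ⟨r, (key W hW r).trans hr⟩⟩
  · intro hm W hW
    obtain ⟨W, rfl⟩ := exists_eq_image U W hW
    have := hm W
    rw [ConcreteCategory.isIso_iff_bijective] at this
    exact ⟨fun a b hab => this.1 ((key W hW a).trans (hab.trans (key W hW b).symm)),
      fun b => let ⟨r, hr⟩ := this.2 b; ⟨r, (key W hW r).symm.trans hr⟩⟩

lemma image_top_le (U : X.Opens) : U.ι ''ᵁ ⊤ ≤ U := by simp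

lemma IsInvertible.exists_isGen {L : X.Modules} (hL : IsInvertible L) (x : X) :
    ∃ U : X.Opens, x ∈ U ∧ ∃ m : Γ(L, U), IsGen m := by
  obtain ⟨U, hxU, ⟨e⟩⟩ := hL x
  have hU : U ≤ U.ι ''ᵁ ⊤ := by simp
  let e' : structureSheaf U ≅ L.restrict U.ι := (e ≪≫ freeOneIso _).symm
  let m₀ : Γ(L, U.ι ''ᵁ ⊤) := e'.hom.app ⊤ (1 : Γ(U, ⊤))
  refine ⟨U, hxU, res L hU m₀, ?_⟩
  rw [isGen_iff_isIso _ (image_top_le U)]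
  have h0 : res L (image_top_le U) (res L hU m₀) = m₀ :=
    (res_res _ _ _ _).trans (res_self L _)
  have : homOfSection (L.restrict U.ι) (res L (image_top_le U) (res L hU m₀)) = e'.hom := by
    apply unit_hom_ext
    refine (homOfSection_app _ _ _ _).trans ((one_smul _ _).trans ?_)
    exact (res_self (L.restrict U.ι) _).trans h0
  rw [this]
  infer_instance

lemma IsInvertible.of_isGen {L : X.Modules}
    (h : ∀ x : X, ∃ U : X.Opens, x ∈ U ∧ ∃ m : Γ(L, U), IsGen m) : IsInvertible L := by
  intro x
  obtain ⟨U, hxU, m, hm⟩ := h x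
  rw [isGen_iff_isIso _ (image_top_le U)] at hm
  exact ⟨U, hxU, ⟨(asIso (homOfSection (L.restrict U.ι) (res L (image_top_le U) m))).symm ≪≫
    (freeOneIso _).symm⟩⟩

lemma IsInvertible.pullback (f : X ⟶ Y) {L : Y.Modules} (hL : IsInvertible L) :
    IsInvertible ((pullback f).obj L) := fun x => (hL (f x)).pullback f

lemma exists_isGen_le {L : X.Modules} (hL : IsInvertible L) {U : X.Opens} (x : X) (hx : x ∈ U) :
    ∃ V : X.Opens, x ∈ V ∧ ∃ _ : V ≤ U, ∃ m : Γ(L, V), IsGen m := by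
  obtain ⟨V, hxV, m, hm⟩ := hL.exists_isGen x
  exact ⟨U ⊓ V, ⟨hx, hxV⟩, inf_le_left, _, hm.res inf_le_right⟩

/-- Every local section of the presheaf tensor product of modules with generators is a multiple
of the tensor product of the generators. -/
lemma exists_smul_tmul {L L' : X.Modules} {U : X.Opens} {m : Γ(L, U)} {m' : Γ(L', U)}
    (hm : IsGen m) (hm' : IsGen m') (z : TensorProduct Γ(X, U) Γ(L, U) Γ(L', U)) :
    ∃ r : Γ(X, U), z = r • TensorProduct.tmul Γ(X, U) m m' := by
  induction z using TensorProduct.induction_on with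
  | zero => exact ⟨0, (zero_smul _ _).symm⟩
  | tmul a b =>
    obtain ⟨r, hr⟩ := (hm U le_rfl).2 a
    obtain ⟨r', hr'⟩ := (hm' U le_rfl).2 b
    simp only [res_self] at hr hr'
    exact ⟨r * r', by rw [← hr, ← hr', TensorProduct.smul_tmul_smul]⟩
  | add a b ha hb =>
    obtain ⟨r, rfl⟩ := ha
    obtain ⟨r', rfl⟩ := hb
    exact ⟨r + r', (add_smul _ _ _).symm⟩

lemma smul_tmul_injective {L L' : X.Modules} {U : X.Opens} {m : Γ(L, U)} {m' : Γ(L', U)}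
    (hm : IsGen m) (hm' : IsGen m') {r : Γ(X, U)}
    (h : r • TensorProduct.tmul Γ(X, U) m m' = 0) : r = 0 := by
  have b : Function.Bijective (LinearMap.toSpanSingleton Γ(X, U) Γ(L, U) m) := by
    have := hm U le_rfl
    simp only [res_self] at this
    exact this
  have b' : Function.Bijective (LinearMap.toSpanSingleton Γ(X, U) Γ(L', U) m') := by
    have := hm' U le_rfl
    simp only [res_self] at this
    exact this
  let e := TensorProduct.congr (LinearEquiv.ofBijective _ b) (LinearEquiv.ofBijective _ b')
  have he : e (r ⊗ₜ 1) = r • TensorProduct.tmul Γ(X, U) m m' := by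
    simp [e, TensorProduct.smul_tmul']
  rw [h, map_eq_zero_iff _ e.injective] at he
  have := congrArg (TensorProduct.lid Γ(X, U) Γ(X, U)) he
  simpa using this

lemma isGen_of_local {M : X.Modules} {U : X.Opens} (m : Γ(M, U))
    (h1 : ∀ (W : X.Opens) (h : W ≤ U) (r : Γ(X, W)), r • res M h m = 0 → ∀ x ∈ W,
      ∃ V : X.Opens, x ∈ V ∧ ∃ hV : V ≤ W, res (structureSheaf X) hV r = 0)
    (h2 : ∀ (W : X.Opens) (_ : W ≤ U) (n : Γ(M, W)), ∀ x ∈ W,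
      ∃ V : X.Opens, x ∈ V ∧ ∃ (hV : V ≤ W) (hVU : V ≤ U) (r : Γ(X, V)),
        r • res M hVU m = res M hV n) : IsGen m := by
  rw [isGen_iff_isIso _ (image_top_le U)]
  have key := homOfSection_restrict_app m (image_top_le U)
  have hle : ∀ W : (U : Scheme.{u}).Opens, U.ι ''ᵁ W ≤ U := fun W => by
    simpa using U.ι.image_le_opensRange W
  have hm : Mono (homOfSection (M.restrict U.ι) (res M (image_top_le U) m)) := by
    rw [mono_iff]
    intro W
    rw [injective_iff_map_eq_zero]
    intro r hr
    refine eq_of_locally_eq (structureSheaf X) (U := U.ι ''ᵁ W) r 0 fun x hx => ?_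
    obtain ⟨V, hxV, hV, e⟩ := h1 _ (hle W) r ((key W (hle W) r).symm.trans hr) x hx
    exact ⟨V, hxV, hV, e.trans (res_zero _ _).symm⟩
  have he : Epi (homOfSection (M.restrict U.ι) (res M (image_top_le U) m)) := by
    refine epi_of_locally_surjective _ fun W n x hx => ?_
    obtain ⟨V, hxV, hV, hVU, r, e⟩ := h2 (U.ι ''ᵁ W) (hle W) n (U.ι x) ⟨x, hx, rfl⟩
    obtain ⟨V', rfl⟩ := exists_eq_image U V hVU
    have hV' : V' ≤ W := (Scheme.Hom.image_le_image_iff _ _ _).1 hV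
    refine ⟨V', ?_, hV', r, (key V' hVU r).trans e⟩
    obtain ⟨y, hy, hyx⟩ := hxV
    rwa [← U.ι.isOpenEmbedding.injective hyx]
  exact isIso_of_mono_of_epi _

lemma IsGen.tmul {L L' : X.Modules} {U : X.Opens} {m : Γ(L, U)} {m' : Γ(L', U)}
    (hm : IsGen m) (hm' : IsGen m') : IsGen (tmul m m') := by
  let P := PresheafOfModules.Monoidal.tensorObj (R := X.presheaf) L.val L'.val
  have key : ∀ (W : X.Opens) (h : W ≤ U) (r : Γ(X, W)), r • ChernUniversal.res (tensor L L') h (ChernUniversal.tmul m m') =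
      (toSheafify P).app (.op W) (r • TensorProduct.tmul Γ(X, W) (M := Γ(L, W)) (N := Γ(L', W))
        (ChernUniversal.res L h m) (ChernUniversal.res L' h m')) := by
    intro W h r
    exact (congrArg (r • ·) (res_tmul h m m')).trans
      (((toSheafify P).app (.op W)).hom.map_smul _ _).symm
  apply isGen_of_local
  · intro W h r hr x hx
    obtain ⟨V, hxV, hV, e⟩ := toSheafify_locally_injective P _ ((key W h r).symm.trans hr) x hx
    refine ⟨V, hxV, hV, ?_⟩
    refine smul_tmul_injective (hm.res (hV.trans h)) (hm'.res (hV.trans h)) (Eq.trans ?_ e)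
    refine Eq.trans ?_ (PresheafOfModules.map_smul P (homOfLE hV).op r _).symm
    refine congrArg ((X.presheaf.map (homOfLE hV).op r) • ·) ?_
    have e1 : ChernUniversal.res L hV (ChernUniversal.res L h m) =
        ChernUniversal.res L (hV.trans h) m := res_res _ _ _ _
    have e2 : ChernUniversal.res L' hV (ChernUniversal.res L' h m') =
        ChernUniversal.res L' (hV.trans h) m' := res_res _ _ _ _
    rw [← e1, ← e2]
    rfl
  · intro W h n x hx
    obtain ⟨V, hxV, hV, s, hs⟩ := toSheafify_locally_surjective P n x hx
    obtain ⟨r, hr⟩ := exists_smul_tmul (hm.res (hV.trans h)) (hm'.res (hV.trans h)) s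
    refine ⟨V, hxV, hV, hV.trans h, r, (key V _ r).trans (Eq.trans ?_ hs)⟩
    exact congrArg ((toSheafify P).app (.op V)) hr.symm

lemma IsInvertible.tensor {L L' : X.Modules} (hL : IsInvertible L) (hL' : IsInvertible L') :
    IsInvertible (tensor L L') := by
  refine .of_isGen fun x => ?_
  obtain ⟨U, hxU, m, hm⟩ := hL.exists_isGen x
  obtain ⟨V, hxV, hV, m', hm'⟩ := exists_isGen_le hL' x hxU
  exact ⟨V, hxV, _, (hm.res hV).tmul hm'⟩

/-! Pullback of tensor products. -/

/-- The pullback of a section. -/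
def pullSec (f : X ⟶ Y) {L : Y.Modules} {V : Y.Opens} (m : Γ(L, V)) :
    Γ((pullback f).obj L, f ⁻¹ᵁ V) :=
  ((pullbackPushforwardAdjunction f).unit.app L).app V m

lemma res_pullSec (f : X ⟶ Y) {L : Y.Modules} {U V : Y.Opens} (h : V ≤ U) (m : Γ(L, U)) :
    res ((pullback f).obj L) (f.preimage_mono h) (pullSec f m) = pullSec f (res L h m) :=
  (app_res ((pullbackPushforwardAdjunction f).unit.app L) h m).symm

lemma pullSec_smul (f : X ⟶ Y) {L : Y.Modules} {V : Y.Opens} (r : Γ(Y, V)) (m : Γ(L, V)) :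
    pullSec f (r • m) = f.app V r • pullSec f m :=
  Scheme.Modules.Hom.app_smul ((pullbackPushforwardAdjunction f).unit.app L) r m

lemma pullSec_add (f : X ⟶ Y) {L : Y.Modules} {V : Y.Opens} (m m' : Γ(L, V)) :
    pullSec f (m + m') = pullSec f m + pullSec f m' :=
  map_add (((pullbackPushforwardAdjunction f).unit.app L).app V).hom m m'

lemma map_pullSec (f : X ⟶ Y) {L L' : Y.Modules} (φ : L ⟶ L') {V : Y.Opens} (m : Γ(L, V)) :
    ((pullback f).map φ).app (f ⁻¹ᵁ V) (pullSec f m) = pullSec f (φ.app V m) :=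
  (congrArg (fun a : L ⟶ _ => a.app V m)
    ((pullbackPushforwardAdjunction f).unit.naturality φ)).symm

lemma pullback_hom_ext (f : X ⟶ Y) {L : Y.Modules} {N : X.Modules}
    {φ ψ : (pullback f).obj L ⟶ N}
    (h : ∀ (V : Y.Opens) (m : Γ(L, V)), φ.app _ (pullSec f m) = ψ.app _ (pullSec f m)) : φ = ψ := by
  apply ((pullbackPushforwardAdjunction f).homEquiv _ _).injective
  ext V m
  rw [Adjunction.homEquiv_unit, Adjunction.homEquiv_unit]
  exact h V m

lemma exists_pullback_desc (f : X ⟶ Y) {L : Y.Modules} {N : X.Modules}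
    (φ : L ⟶ (pushforward f).obj N) : ∃ ψ : (pullback f).obj L ⟶ N,
      ∀ (V : Y.Opens) (m : Γ(L, V)), ψ.app _ (pullSec f m) = φ.app V m := by
  refine ⟨((pullbackPushforwardAdjunction f).homEquiv _ _).symm φ, fun V m => ?_⟩
  have := ((pullbackPushforwardAdjunction f).homEquiv _ _).apply_symm_apply φ
  rw [Adjunction.homEquiv_unit] at this
  exact congrArg (fun a : L ⟶ _ => a.app V m) this

lemma restrict_pullback_hom_ext (f : X ⟶ Y) {L : Y.Modules} {V : Y.Opens} {m : Γ(L, V)}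
    (hm : IsGen m) {N : (f ⁻¹ᵁ V : X.Opens).toScheme.Modules}
    {α β : ((pullback f).obj L).restrict (f ⁻¹ᵁ V).ι ⟶ N}
    (h : α.app ⊤ (res ((pullback f).obj L) (image_top_le _) (pullSec f m)) =
      β.app ⊤ (res ((pullback f).obj L) (image_top_le _) (pullSec f m))) : α = β := by
  set j := (f ⁻¹ᵁ V).ι with hj
  apply ((restrictAdjunction j).homEquiv _ _).injective
  refine pullback_hom_ext f fun U s => ?_
  rw [Adjunction.homEquiv_unit, Adjunction.homEquiv_unit]
  let F := (pullback f).obj L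
  have e : ∀ (U : Y.Opens), j ''ᵁ (j ⁻¹ᵁ f ⁻¹ᵁ U) ≤ f ⁻¹ᵁ U := fun U => j.image_preimage_le _
  change α.app (j ⁻¹ᵁ f ⁻¹ᵁ U) (res F (e U) (pullSec f s)) =
    β.app (j ⁻¹ᵁ f ⁻¹ᵁ U) (res F (e U) (pullSec f s))
  refine eq_of_locally_eq N _ _ fun x hx => ?_
  have hle : j ⁻¹ᵁ f ⁻¹ᵁ (U ⊓ V) ≤ j ⁻¹ᵁ f ⁻¹ᵁ U := fun y hy => hy.1
  refine ⟨j ⁻¹ᵁ f ⁻¹ᵁ (U ⊓ V), ⟨hx, x.2⟩, hle, ?_⟩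
  obtain ⟨r, hr⟩ := (hm _ inf_le_right).2 (res L (inf_le_left : U ⊓ V ≤ U) s)
  simp only at hr
  have hle' : j ''ᵁ (j ⁻¹ᵁ f ⁻¹ᵁ (U ⊓ V)) ≤ j ''ᵁ (j ⁻¹ᵁ f ⁻¹ᵁ U) := Scheme.Hom.image_mono _ hle
  have hle'' : j ''ᵁ (j ⁻¹ᵁ f ⁻¹ᵁ (U ⊓ V)) ≤ j ''ᵁ ⊤ := Scheme.Hom.image_mono _ le_top
  have h1 : res F hle' (res F (e U) (pullSec f s)) =
      X.presheaf.map (homOfLE (e (U ⊓ V))).op (f.app _ r) •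
        res F hle'' (res F (image_top_le _) (pullSec f m)) := by
    rw [res_res, res_res]
    have a1 := res_res F (f.preimage_mono (inf_le_left : U ⊓ V ≤ U)) (e (U ⊓ V)) (pullSec f s)
    have a2 := res_res F (f.preimage_mono (inf_le_right : U ⊓ V ≤ V)) (e (U ⊓ V)) (pullSec f m)
    refine a1.symm.trans ?_
    rw [res_pullSec f (inf_le_left : U ⊓ V ≤ U), ← hr, pullSec_smul, res_smul]
    refine congrArg (_ • ·) (Eq.trans ?_ a2)
    rw [res_pullSec]
  have key : ∀ γ : F.restrict j ⟶ N, res N hle (γ.app (j ⁻¹ᵁ f ⁻¹ᵁ U) (res F (e U) (pullSec f s))) =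
      (j.appIso _).hom (X.presheaf.map (homOfLE (e (U ⊓ V))).op (f.app _ r)) •
        res N le_top (γ.app ⊤ (res F (image_top_le _) (pullSec f m))) := by
    intro γ
    have b1 := app_res γ hle (res F (e U) (pullSec f s))
    have b2 := app_res γ (le_top : j ⁻¹ᵁ f ⁻¹ᵁ (U ⊓ V) ≤ ⊤) (res F (image_top_le _) (pullSec f m))
    rw [← b1, ← b2]
    have b3 := Scheme.Modules.Hom.app_smul γ
      ((j.appIso _).hom (X.presheaf.map (homOfLE (e (U ⊓ V))).op (f.app _ r)))
      (res (F.restrict j) (le_top : j ⁻¹ᵁ f ⁻¹ᵁ (U ⊓ V) ≤ ⊤) (res F (image_top_le _) (pullSec f m)))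
    refine Eq.trans ?_ b3
    refine congrArg (γ.app _) (h1.trans ?_)
    refine congrArg (fun a : Γ(X, j ''ᵁ (j ⁻¹ᵁ f ⁻¹ᵁ (U ⊓ V))) => a • 
      res F hle'' (res F (image_top_le _) (pullSec f m))) ?_
    exact (ConcreteCategory.congr_hom (j.appIso _).hom_inv_id _).symm
  rw [key, key, h]

lemma exists_isGen_pullSec (f : X ⟶ Y) {L : Y.Modules} (hL : IsInvertible L) {V : Y.Opens}
    {m : Γ(L, V)} (hm : IsGen m) (x : X) (hx : x ∈ f ⁻¹ᵁ V) :
    ∃ W : X.Opens, x ∈ W ∧ ∃ hW : W ≤ f ⁻¹ᵁ V, IsGen (res ((pullback f).obj L) hW (pullSec f m)) := by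
  let F := (pullback f).obj L
  let j := (f ⁻¹ᵁ V).ι
  let μ := homOfSection (F.restrict j) (res F (image_top_le _) (pullSec f m))
  have hμ1 : μ.app ⊤ (1 : Γ((f ⁻¹ᵁ V : X.Opens).toScheme, ⊤)) = res F (image_top_le _) (pullSec f m) :=
    (homOfSection_app _ _ _ _).trans ((one_smul _ _).trans (res_self (F.restrict j) _))
  have : Epi μ := by
    refine ⟨fun {N} α β hαβ => restrict_pullback_hom_ext f hm ?_⟩
    have := congrArg (fun γ : structureSheaf _ ⟶ N =>
      γ.app ⊤ (1 : Γ((f ⁻¹ᵁ V : X.Opens).toScheme, ⊤))) hαβ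
    exact (congrArg (α.app ⊤) hμ1).symm.trans (this.trans (congrArg (β.app ⊤) hμ1))
  obtain ⟨W, hxW, hW, g, hg⟩ := exists_isGen_le (hL.pullback f) x hx
  obtain ⟨W, rfl⟩ := exists_eq_image _ W hW
  obtain ⟨x, hxW', rfl⟩ := hxW
  obtain ⟨V', hxV', hV', t, ht⟩ := exists_local_lift μ (U := W) g x hxW'
  have hle : j ''ᵁ V' ≤ f ⁻¹ᵁ V := (Scheme.Hom.image_mono _ hV').trans hW
  refine ⟨j ''ᵁ V', ⟨x, hxV', rfl⟩, hle, ?_⟩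
  have h1 := homOfSection_restrict_app (M := F) (pullSec f m) (image_top_le _) V' hle t
  exact (hg.res (Scheme.Hom.image_mono j hV')).of_smul (h1.symm.trans ht)

/-- The pullback of a tensor product of invertible sheaves. -/
lemma pullback_tensor (f : X ⟶ Y) {L L' : Y.Modules} (hL : IsInvertible L) (hL' : IsInvertible L') :
    Nonempty ((pullback f).obj (tensor L L') ≅
      tensor ((pullback f).obj L) ((pullback f).obj L')) := by
  let N := tensor ((pullback f).obj L) ((pullback f).obj L')
  obtain ⟨φ, hφ⟩ := exists_tensor_desc (N := (pushforward f).obj N)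
    (fun U (s : Γ(L, U)) (t : Γ(L', U)) => (tmul (pullSec f s) (pullSec f t) : Γ(N, f ⁻¹ᵁ U)))
    (fun U s s' t => by
      refine Eq.trans ?_ (add_tmul _ _ _)
      rw [pullSec_add])
    (fun U s t t' => by
      refine Eq.trans ?_ (tmul_add _ _ _)
      rw [pullSec_add])
    (fun U r s t => by
      have := tmul_smul_smul (f.app U r) 1 (pullSec f s) (pullSec f t)
      rw [one_smul, mul_one] at this
      rw [pullSec_smul]
      exact this)
    (fun U r s t => by
      have := tmul_smul_smul 1 (f.app U r) (pullSec f s) (pullSec f t)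
      rw [one_smul, one_mul] at this
      rw [pullSec_smul]
      exact this)
    (fun U V h s t => by
      rw [← res_pullSec, ← res_pullSec]
      exact (res_tmul (f.preimage_mono h) (pullSec f s) (pullSec f t)).symm)
  obtain ⟨ψ, hψ⟩ := exists_pullback_desc f φ
  have : IsIso ψ := by
    refine isIso_of_isGen ψ fun x => ?_
    obtain ⟨V, hxV, m, hm⟩ := hL.exists_isGen (f x)
    obtain ⟨V', hxV', hV, m', hm'⟩ := exists_isGen_le hL' (f x) hxV
    obtain ⟨W, hxW, hW, h1⟩ := exists_isGen_pullSec f (hL.tensor hL') ((hm.res hV).tmul hm') x hxV'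
    obtain ⟨W1, hxW1, hW1, h2⟩ := exists_isGen_pullSec f hL (hm.res hV) x hxV'
    obtain ⟨W2, hxW2, hW2, h3⟩ := exists_isGen_pullSec f hL' hm' x hxV'
    refine ⟨W ⊓ W1 ⊓ W2, ⟨⟨hxW, hxW1⟩, hxW2⟩, _,
      h1.res (inf_le_left.trans inf_le_left), ?_⟩
    have h2' := h2.res (inf_le_left.trans inf_le_right : W ⊓ W1 ⊓ W2 ≤ W1)
    have h3' := h3.res (inf_le_right : W ⊓ W1 ⊓ W2 ≤ W2)
    have h4 := h2'.tmul h3'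
    have e : ψ.app _ (res _ (inf_le_left.trans inf_le_left : W ⊓ W1 ⊓ W2 ≤ W) (res _ hW
        (pullSec f (tmul (res L hV m) m')))) = tmul
          (res _ (inf_le_left.trans inf_le_right : W ⊓ W1 ⊓ W2 ≤ W1) (res _ hW1 (pullSec f (res L hV m))))
          (res _ (inf_le_right : W ⊓ W1 ⊓ W2 ≤ W2) (res _ hW2 (pullSec f m'))) := by
      rw [app_res, app_res, hψ, hφ]
      refine (res_res N _ _ _).trans ((res_tmul _ _ _).trans ?_)
      rw [res_res, res_res]
    rw [e]
    exact h4
  exact ⟨asIso ψ⟩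

/-! Projective bundles and chains of projective bundles. -/

lemma pullbackComp_pullSec (f : X ⟶ Y) (g : Y ⟶ Z) {M : Z.Modules} {V : Z.Opens} (m : Γ(M, V)) :
    ((pullbackComp f g).hom.app M).app (f ⁻¹ᵁ g ⁻¹ᵁ V) (pullSec f (pullSec g m)) =
      pullSec (f ≫ g) m := by
  have h := unit_conjugateEquiv
    ((pullbackPushforwardAdjunction g).comp (pullbackPushforwardAdjunction f))
      (pullbackPushforwardAdjunction (f ≫ g)) (pullbackComp f g).inv M
  rw [conjugateEquiv_pullbackComp_inv] at h
  have h1 := congrArg (fun a : M ⟶ _ => a.app V m) h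
  have h2 : pullSec f (pullSec g m) =
      ((pullbackComp f g).inv.app M).app (f ⁻¹ᵁ g ⁻¹ᵁ V) (pullSec (f ≫ g) m) := by
    refine Eq.trans ?_ h1
    rw [Adjunction.comp_unit_app]
    rfl
  rw [h2]
  have h3 : (pullbackComp f g).inv.app M ≫ (pullbackComp f g).hom.app M = 𝟙 _ := by simp
  exact congrArg (fun a : (pullback (f ≫ g)).obj M ⟶ _ => a.app (f ⁻¹ᵁ g ⁻¹ᵁ V) (pullSec (f ≫ g) m)) h3

/-- The canonical isomorphism `h^* p^* ≅ g^*` when `h ≫ p = g`. -/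
def pullbackCompIso {f : X ⟶ Y} {g : Y ⟶ Z} {k : X ⟶ Z} (w : f ≫ g = k) :
    pullback g ⋙ pullback f ≅ pullback k :=
  pullbackComp f g ≪≫ pullbackCongr w

lemma pullback_hom_ext₂ (f : X ⟶ Y) (g : Y ⟶ Z) {M : Z.Modules} {N : X.Modules}
    {φ ψ : (pullback f).obj ((pullback g).obj M) ⟶ N}
    (h : ∀ (V : Z.Opens) (m : Γ(M, V)), φ.app _ (pullSec f (pullSec g m)) =
      ψ.app _ (pullSec f (pullSec g m))) : φ = ψ := by
  apply ((pullbackPushforwardAdjunction f).homEquiv _ _).injective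
  refine pullback_hom_ext g fun V m => ?_
  rw [Adjunction.homEquiv_unit, Adjunction.homEquiv_unit]
  exact h V m

lemma pullback_hom_ext₃ {W : Scheme.{u}} (f : X ⟶ Y) (g : Y ⟶ Z) (k : Z ⟶ W)
    {M : W.Modules} {N : X.Modules}
    {φ ψ : (pullback f).obj ((pullback g).obj ((pullback k).obj M)) ⟶ N}
    (h : ∀ (V : W.Opens) (m : Γ(M, V)), φ.app _ (pullSec f (pullSec g (pullSec k m))) =
      ψ.app _ (pullSec f (pullSec g (pullSec k m)))) : φ = ψ := by
  apply ((pullbackPushforwardAdjunction f).homEquiv _ _).injective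
  refine pullback_hom_ext₂ g k fun V m => ?_
  rw [Adjunction.homEquiv_unit, Adjunction.homEquiv_unit]
  exact h V m

lemma pullbackCompIso_rfl (f : X ⟶ Y) (g : Y ⟶ Z) : pullbackCompIso (rfl : f ≫ g = f ≫ g) = pullbackComp f g := by
  ext; simp [pullbackCompIso, pullbackCongr]

lemma pullbackCompIso_pullSec {f : X ⟶ Y} {g : Y ⟶ Z} {k : X ⟶ Z} (w : f ≫ g = k)
    {M : Z.Modules} {V : Z.Opens} (h : f ⁻¹ᵁ g ⁻¹ᵁ V ≤ k ⁻¹ᵁ V) (m : Γ(M, V)) :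
    ((pullbackCompIso w).hom.app M).app (f ⁻¹ᵁ g ⁻¹ᵁ V) (pullSec f (pullSec g m)) =
      res ((pullback k).obj M) h (pullSec k m) := by
  subst w
  rw [pullbackCompIso_rfl, pullbackComp_pullSec]
  exact (res_self _ _).symm

lemma pullbackCompIso_assoc {W : Scheme.{u}} {f : X ⟶ Y} {g : Y ⟶ Z} {k : Z ⟶ W} {fg : X ⟶ Z}
    {gk : Y ⟶ W} {c : X ⟶ W} (h1 : f ≫ g = fg) (h2 : g ≫ k = gk) (h3 : f ≫ gk = c)
    (h4 : fg ≫ k = c) (M : W.Modules) :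
    (pullback f).map ((pullbackCompIso h2).hom.app M) ≫ (pullbackCompIso h3).hom.app M =
      (pullbackCompIso h1).hom.app ((pullback k).obj M) ≫ (pullbackCompIso h4).hom.app M := by
  refine pullback_hom_ext₃ _ _ _ fun V m => ?_
  have i2 : g ⁻¹ᵁ k ⁻¹ᵁ V ≤ gk ⁻¹ᵁ V := by rw [← h2]; exact le_rfl
  have i3 : f ⁻¹ᵁ gk ⁻¹ᵁ V ≤ c ⁻¹ᵁ V := by rw [← h3]; exact le_rfl
  have i1 : f ⁻¹ᵁ g ⁻¹ᵁ k ⁻¹ᵁ V ≤ fg ⁻¹ᵁ k ⁻¹ᵁ V := by rw [← h1]; exact le_rfl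
  have i4 : fg ⁻¹ᵁ k ⁻¹ᵁ V ≤ c ⁻¹ᵁ V := by rw [← h4]; exact le_rfl
  have e1 := pullbackCompIso_pullSec h1 i1 (pullSec k m)
  have e2 := pullbackCompIso_pullSec h2 i2 m
  have e3 := pullbackCompIso_pullSec h3 i3 m
  have e4 := pullbackCompIso_pullSec h4 i4 m
  have a1 : ((pullback f).map ((pullbackCompIso h2).hom.app M)).app _
      (pullSec f (pullSec g (pullSec k m))) =
      res _ (f.preimage_mono i2) (pullSec f (pullSec gk m)) := by
    refine (map_pullSec f _ _).trans ((congrArg (pullSec f) e2).trans ?_)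
    exact (res_pullSec f i2 _).symm
  have l : ((pullbackCompIso h3).hom.app M).app _
      (res _ (f.preimage_mono i2) (pullSec f (pullSec gk m))) =
      res _ (i1.trans i4) (pullSec c m) :=
    (app_res _ _ _).trans ((congrArg (res _ _) e3).trans (res_res _ _ _ _))
  have r : ((pullbackCompIso h4).hom.app M).app _
      (res _ i1 (pullSec fg (pullSec k m))) = res _ (i1.trans i4) (pullSec c m) :=
    (app_res _ _ _).trans ((congrArg (res _ _) e4).trans (res_res _ _ _ _))
  exact ((congrArg (((pullbackCompIso h3).hom.app M).app _) a1).trans l).trans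
    ((congrArg (((pullbackCompIso h4).hom.app M).app _) e1).trans r).symm

/-- `p : P ⟶ X` is the projective bundle `P(E)` of invertible quotients of `E`: there is an
invertible quotient `q : p^* E ⟶ Q` such that for every `g : T ⟶ X` and every invertible quotient
`φ : g^* E ⟶ L` there is a unique morphism `h : T ⟶ P` over `X` for which `h^* Q` and `L`
are isomorphic as quotients of `g^* E`. -/
def IsProjectiveBundle (E : X.Modules) {P : Scheme.{u}} (p : P ⟶ X) : Prop :=
  ∃ (Q : P.Modules) (q : (pullback p).obj E ⟶ Q), IsInvertible Q ∧ Epi q ∧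
    ∀ (T : Scheme.{u}) (g : T ⟶ X) (L : T.Modules) (φ : (pullback g).obj E ⟶ L),
      IsInvertible L → Epi φ →
        ∃! h : T ⟶ P, ∃ (w : h ≫ p = g) (e : (pullback h).obj Q ≅ L),
          (pullback h).map q ≫ e.hom = (pullbackCompIso w).hom.app E ≫ φ

/-- Projective bundles are stable under base change. -/
lemma IsProjectiveBundle.of_isPullback {E : X.Modules} {P P' : Scheme.{u}} {p : P ⟶ X}
    (hp : IsProjectiveBundle E p) {f : Y ⟶ X} {p' : P' ⟶ Y} {f' : P' ⟶ P}
    (sq : IsPullback f' p' p f) : IsProjectiveBundle ((pullback f).obj E) p' := by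
  obtain ⟨Q, q, hQ, hq, hu⟩ := hp
  let σ : (pullback p').obj ((pullback f).obj E) ≅ (pullback f').obj ((pullback p).obj E) :=
    ((pullbackComp p' f).app E) ≪≫ ((pullbackCompIso sq.w).app E).symm
  have : Epi ((pullback f').map q) := inferInstance
  refine ⟨_, σ.hom ≫ (pullback f').map q, hQ.pullback f', inferInstance, ?_⟩
  intro T g L φ hL hφ
  obtain ⟨h, ⟨w, e, he⟩, huniq⟩ := hu T (g ≫ f) L ((pullbackComp g f).inv.app E ≫ φ) hL
    inferInstance
  have key : ∀ (k : T ⟶ P') (wk : k ≫ p' = g) (w : (k ≫ f') ≫ p = g ≫ f),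
      (pullback k).map σ.hom ≫ (pullbackComp k f').hom.app ((pullback p).obj E) ≫
        (pullbackCompIso w).hom.app E = (pullbackCompIso wk).hom.app ((pullback f).obj E) ≫
          (pullbackComp g f).hom.app E := by
    intro k wk w
    have w' : k ≫ p' ≫ f = g ≫ f := by rw [← wk, Category.assoc]
    have a1 := pullbackCompIso_assoc wk rfl w' rfl E
    have a2 := pullbackCompIso_assoc rfl sq.w w' w E
    rw [pullbackCompIso_rfl, pullbackCompIso_rfl] at a1
    rw [pullbackCompIso_rfl] at a2
    rw [← a1, ← a2]
    simp only [← Category.assoc, ← Functor.map_comp]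
    congr 2
    simp [σ]
  have equiv : ∀ (k : T ⟶ P') (wk : k ≫ p' = g) (w : (k ≫ f') ≫ p = g ≫ f)
      (e : (pullback k).obj ((pullback f').obj Q) ≅ L),
      (pullback k).map (σ.hom ≫ (pullback f').map q) ≫ e.hom =
        (pullbackCompIso wk).hom.app ((pullback f).obj E) ≫ φ ↔
      (pullback (k ≫ f')).map q ≫ ((pullbackComp k f').app Q).inv ≫ e.hom =
        (pullbackCompIso w).hom.app E ≫ (pullbackComp g f).inv.app E ≫ φ := by
    intro k wk w e
    have k1 := key k wk w
    have n : (pullback k).map ((pullback f').map q) ≫ (pullbackComp k f').hom.app Q =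
      (pullbackComp k f').hom.app _ ≫ (pullback (k ≫ f')).map q :=
      (pullbackComp k f').hom.naturality q
    rw [← cancel_epi ((pullback k).map σ.hom ≫ (pullbackComp k f').hom.app ((pullback p).obj E))]
    have l : ((pullback k).map σ.hom ≫ (pullbackComp k f').hom.app ((pullback p).obj E)) ≫
        (pullback (k ≫ f')).map q ≫ ((pullbackComp k f').app Q).inv ≫ e.hom =
        (pullback k).map (σ.hom ≫ (pullback f').map q) ≫ e.hom := by
      rw [Category.assoc, ← reassoc_of% n]
      simp
    have r : ((pullback k).map σ.hom ≫ (pullbackComp k f').hom.app ((pullback p).obj E)) ≫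
        (pullbackCompIso w).hom.app E ≫ (pullbackComp g f).inv.app E ≫ φ =
        (pullbackCompIso wk).hom.app ((pullback f).obj E) ≫ φ := by
      rw [Category.assoc, reassoc_of% k1]
      simp
    rw [l, r]
  have w1 : h ≫ p = g ≫ f := w
  obtain ⟨k, hk, wk⟩ : ∃ k : T ⟶ P', k ≫ f' = h ∧ k ≫ p' = g :=
    ⟨sq.lift h g w1, sq.lift_fst h g w1, sq.lift_snd h g w1⟩
  subst hk
  refine ⟨k, ⟨wk, (pullbackComp k f').app Q ≪≫ e, ?_⟩, ?_⟩
  · rw [equiv k wk w]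
    simpa using he
  · rintro k' ⟨wk', e', he'⟩
    have w' : (k' ≫ f') ≫ p = g ≫ f := by rw [Category.assoc, sq.w, ← Category.assoc, wk']
    exact sq.hom_ext (huniq _ ⟨w', ((pullbackComp k' f').app Q).symm ≪≫ e',
      (equiv k' wk' w' e').1 he'⟩) (wk'.trans wk.symm)

/-- `E` is locally free of finite and everywhere positive rank, so that `P(E)` has nonempty fibres
over every point of the base. -/
def IsLocallyFreePositive (E : X.Modules) : Prop := ∀ x : X, ∃ n : ℕ, 0 < n ∧ HasRankAt E x n

lemma IsLocallyFreePositive.pullback (f : X ⟶ Y) {E : Y.Modules} (hE : IsLocallyFreePositive E) :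
    IsLocallyFreePositive ((pullback f).obj E) := fun x =>
  let ⟨n, hn, h⟩ := hE (f x); ⟨n, hn, h.pullback f⟩

/-- Finite chains (possibly of length `0`) of projective bundles of locally free sheaves of
everywhere positive rank. -/
inductive Tower {P' : Scheme.{u}} : ∀ {X : Scheme.{u}}, (P' ⟶ X) → Prop
  | id : Tower (𝟙 P')
  | comp {P X : Scheme.{u}} (q : P' ⟶ P) (p : P ⟶ X) (E : X.Modules) (hE : IsLocallyFreePositive E)
      (hp : IsProjectiveBundle E p) (hq : Tower q) : Tower (q ≫ p)

lemma Tower.trans {P' P X : Scheme.{u}} {q : P' ⟶ P} {p : P ⟶ X} (hq : Tower q) (hp : Tower p) :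
    Tower (q ≫ p) := by
  induction hp with
  | id => simpa using hq
  | comp p' p E hE hp _ ih =>
    rw [← Category.assoc]
    exact .comp _ _ E hE hp ih

lemma Tower.exists_isPullback {P X Y : Scheme.{u}} {p : P ⟶ X} (hp : Tower p) (f : Y ⟶ X) :
    ∃ (P' : Scheme.{u}) (f' : P' ⟶ P) (p' : P' ⟶ Y), f' ≫ p = p' ≫ f ∧ Tower p' := by
  induction hp generalizing Y with
  | id => exact ⟨Y, f, 𝟙 Y, by simp, .id⟩
  | comp q p E hE hp _ ih =>
    obtain ⟨P', f', q', e, hq'⟩ := ih (Limits.pullback.fst p f)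
    refine ⟨P', f', q' ≫ Limits.pullback.snd p f, ?_, ?_⟩
    · rw [← Category.assoc, e, Category.assoc, Limits.pullback.condition, Category.assoc]
    · exact .comp _ _ _ (hE.pullback f) (hp.of_isPullback (IsPullback.of_hasPullback p f)) hq'

/-! Locally free sheaves of finite rank, and short exact sequences. -/

/-- Locally free sheaves of finite rank on `X`. -/
abbrev VB (X : Scheme.{u}) := {F : X.Modules // IsLocallyFree F}

lemma IsLocallyFree.pullback (f : X ⟶ Y) {F : Y.Modules} (hF : IsLocallyFree F) :
    IsLocallyFree ((pullback f).obj F) := fun x =>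
  let ⟨n, h⟩ := hF (f x); ⟨n, h.pullback f⟩

lemma IsInvertible.isLocallyFree {L : X.Modules} (hL : IsInvertible L) : IsLocallyFree L :=
  fun x => ⟨1, hL x⟩

/-- The pullback `f^* F`. -/
def VB.pull (f : X ⟶ Y) (F : VB Y) : VB X := ⟨(pullback f).obj F.1, F.2.pullback f⟩

/-- There is a short exact sequence `0 ⟶ E ⟶ G ⟶ F ⟶ 0`. -/
def IsExtension (E G F : VB X) : Prop :=
  ∃ (a : E.1 ⟶ G.1) (b : G.1 ⟶ F.1) (w : a ≫ b = 0), (ShortComplex.mk a b w).ShortExact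

lemma IsExtension.pull (f : X ⟶ Y) {E G F : VB Y} (h : IsExtension E G F) :
    IsExtension (E.pull f) (G.pull f) (F.pull f) := by
  obtain ⟨a, b, w, hS⟩ := h
  exact ⟨_, _, _, pullback_shortExact f hS F.2⟩

/-- `i` is greater than the rank of `F`, which is a locally constant function on `X`. -/
def RankLT (F : VB X) (i : ℕ) : Prop := 0 < i ∧ ∀ x : X, ∃ m < i, HasRankAt F.1 x m

/-- The tensor product of two invertible sheaves. -/
def tensorVB {L L' : VB X} (hL : IsInvertible L.1) (hL' : IsInvertible L'.1) : VB X :=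
  ⟨tensor L.1 L'.1, (hL.tensor hL').isLocallyFree⟩

/-! The Grothendieck group. -/

/-- The relations `[G] = [E] + [F]` for short exact sequences `0 ⟶ E ⟶ G ⟶ F ⟶ 0`. -/
def kRelations (X : Scheme.{u}) : AddSubgroup (FreeAbelianGroup (VB X)) :=
  AddSubgroup.closure {x | ∃ E G F : VB X, IsExtension E G F ∧
    x = FreeAbelianGroup.of G - (FreeAbelianGroup.of E + FreeAbelianGroup.of F)}

/-- The Grothendieck group of locally free sheaves of finite rank on `X`. Only the underlying
set-valued functor matters for Chern classes, so the product is not constructed. -/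
abbrev K (X : Scheme.{u}) := FreeAbelianGroup (VB X) ⧸ kRelations X

/-- The class `[F]`. -/
def K.of (F : VB X) : K X := QuotientAddGroup.mk (FreeAbelianGroup.of F)

/-- The additive homomorphism on `K X` given by an additive function. -/
def K.lift {A : Type*} [AddCommGroup A] (φ : VB X → A)
    (h : ∀ E G F : VB X, IsExtension E G F → φ G = φ E + φ F) : K X →+ A :=
  QuotientAddGroup.lift _ (FreeAbelianGroup.lift φ) (by
    rw [kRelations, AddSubgroup.closure_le]
    rintro x ⟨E, G, F, hx, rfl⟩
    simp [h E G F hx])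

@[simp] lemma K.lift_of {A : Type*} [AddCommGroup A] (φ : VB X → A)
    (h : ∀ E G F : VB X, IsExtension E G F → φ G = φ E + φ F) (F : VB X) :
    K.lift φ h (K.of F) = φ F := by
  change FreeAbelianGroup.lift φ (FreeAbelianGroup.of F) = _
  simp

lemma K.hom_ext {A : Type*} [AddCommGroup A] {φ ψ : K X →+ A}
    (h : ∀ F, φ (K.of F) = ψ (K.of F)) : φ = ψ := by
  apply QuotientAddGroup.addMonoidHom_ext
  ext F
  exact h F

lemma K.of_isExtension {E G F : VB X} (h : IsExtension E G F) : K.of G = K.of E + K.of F := by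
  have : FreeAbelianGroup.of G - (FreeAbelianGroup.of E + FreeAbelianGroup.of F) ∈ kRelations X :=
    AddSubgroup.subset_closure ⟨E, G, F, h, rfl⟩
  have := (QuotientAddGroup.eq_zero_iff _).2 this
  exact sub_eq_zero.1 this

/-- The map `f^* : K(Y) ⟶ K(X)`. -/
def K.pull (f : X ⟶ Y) : K Y →+ K X :=
  K.lift (fun F => K.of (F.pull f)) fun _ _ _ h => K.of_isExtension (h.pull f)

@[simp] lemma K.pull_of (f : X ⟶ Y) (F : VB Y) : K.pull f (K.of F) = K.of (F.pull f) :=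
  K.lift_of _ _ _

/-! The ring of symbols. -/

/-- The polynomial ring `ℤ[R_X]` on the symbols `c_i(F)`. -/
abbrev Poly (X : Scheme.{u}) := MvPolynomial (ℕ × VB X) ℤ

/-- The symbol `c_i(F)`. -/
abbrev sym (i : ℕ) (F : VB X) : Poly X := MvPolynomial.X (i, F)

/-- The generators of `I_X`. -/
inductive IsRelation : Poly X → Prop
  | zero (F : VB X) : IsRelation (sym 0 F - 1)
  | rank (i : ℕ) (F : VB X) (h : RankLT F i) : IsRelation (sym i F)
  | whitney (i : ℕ) (E G F : VB X) (h : IsExtension E G F) :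
      IsRelation (sym i G - ∑ j ∈ Finset.range (i + 1), sym (i - j) F * sym j E)
  | tensor (L L' : VB X) (hL : IsInvertible L.1) (hL' : IsInvertible L'.1) :
      IsRelation (sym 1 (tensorVB hL hL') - sym 1 L - sym 1 L')

/-- The ideal `I_X`. -/
def relIdeal (X : Scheme.{u}) : Ideal (Poly X) := Ideal.span {x | IsRelation x}

/-- `f^*` on symbols. -/
def pullPoly (f : X ⟶ Y) : Poly Y →+* Poly X :=
  (MvPolynomial.rename (R := ℤ) fun s : ℕ × VB Y => (s.1, s.2.pull f)).toRingHom

@[simp] lemma pullPoly_sym (f : X ⟶ Y) (i : ℕ) (F : VB Y) :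
    pullPoly f (sym i F) = sym i (F.pull f) := MvPolynomial.rename_X _ _

lemma IsRelation.mem {x : Poly X} (h : IsRelation x) : x ∈ relIdeal X := Ideal.subset_span h

lemma hasRankAt_free (n : ℕ) (x : X) : HasRankAt (freeModule X n) x n :=
  ⟨⊤, trivial, ⟨freeRestrictIso _ n⟩⟩

def freeVB (X : Scheme.{u}) (n : ℕ) : VB X := ⟨freeModule X n, fun x => ⟨n, hasRankAt_free n x⟩⟩

lemma isExtension_of_iso {F F' : VB X} (e : F.1 ≅ F'.1) : IsExtension F F' (freeVB X 0) := by
  have hz : Limits.IsZero (freeModule X 0) := by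
    rw [Limits.IsZero.iff_id_eq_zero]
    exact free_hom_ext fun i => i.elim0
  refine ⟨e.hom, 0, by simp, ?_⟩
  have : Epi (0 : F'.1 ⟶ (freeVB X 0).1) := ⟨fun _ _ _ => hz.eq_of_src _ _⟩
  exact { exact := (ShortComplex.exact_iff_epi _ rfl).2 (inferInstanceAs (Epi e.hom))
          mono_f := inferInstanceAs (Mono e.hom)
          epi_g := this }

lemma mk_sym_eq {i : ℕ} {F : VB X} (h : RankLT F i) :
    Ideal.Quotient.mk (relIdeal X) (sym i F) = 0 :=
  Ideal.Quotient.eq_zero_iff_mem.2 (Ideal.subset_span (.rank i F h))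

lemma mk_whitney (i : ℕ) {E G F : VB X} (h : IsExtension E G F) :
    Ideal.Quotient.mk (relIdeal X) (sym i G) = ∑ j ∈ Finset.range (i + 1),
      Ideal.Quotient.mk (relIdeal X) (sym (i - j) F) * Ideal.Quotient.mk (relIdeal X) (sym j E) := by
  have := Ideal.Quotient.eq.2 (IsRelation.whitney i E G F h).mem
  simpa using this

lemma mk_zero (F : VB X) : Ideal.Quotient.mk (relIdeal X) (sym 0 F) = 1 := by
  simpa using Ideal.Quotient.eq.2 (IsRelation.zero F).mem

lemma mk_iso (i : ℕ) {F F' : VB X} (e : F.1 ≅ F'.1) :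
    Ideal.Quotient.mk (relIdeal X) (sym i F) = Ideal.Quotient.mk (relIdeal X) (sym i F') := by
  rw [mk_whitney i (isExtension_of_iso e), Finset.sum_eq_single i]
  · simp [mk_zero]
  · intro j hj hji
    rw [mk_sym_eq (F := freeVB X 0), zero_mul]
    have := Finset.mem_range.1 hj
    exact ⟨by omega, fun x => ⟨0, by omega, hasRankAt_free 0 x⟩⟩
  · simp

lemma pullPoly_mem (f : X ⟶ Y) {x : Poly Y} (hx : x ∈ relIdeal Y) : pullPoly f x ∈ relIdeal X := by
  have : relIdeal Y ≤ (relIdeal X).comap (pullPoly f) := by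
    refine Ideal.span_le.2 fun x hx => ?_
    change pullPoly f x ∈ relIdeal X
    cases hx with
    | zero F => 
      simpa using (IsRelation.zero (F.pull f)).mem
    | rank i F h =>
      rw [pullPoly_sym]
      exact Ideal.subset_span (.rank i _ ⟨h.1, fun x =>
        let ⟨m, hm, hr⟩ := h.2 (f x); ⟨m, hm, hr.pullback f⟩⟩)
    | whitney i E G F h =>
      simpa using (IsRelation.whitney i _ _ _ (h.pull f)).mem
    | tensor L L' hL hL' =>
      obtain ⟨e⟩ := pullback_tensor f hL hL'
      have h1 := mk_iso 1 (F := (tensorVB hL hL').pull f)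
        (F' := tensorVB (L := L.pull f) (L' := L'.pull f) (hL.pullback f) (hL'.pullback f)) e
      have h2 := (IsRelation.tensor (L.pull f) (L'.pull f) (hL.pullback f)
        (hL'.pullback f)).mem
      have h3 := (relIdeal X).add_mem (Ideal.Quotient.eq.1 h1) h2
      rw [map_sub, map_sub, pullPoly_sym, pullPoly_sym, pullPoly_sym]
      convert h3 using 1
      ring
  exact this hx

lemma pullPoly_congr {f g : X ⟶ Y} (h : f = g) (x : Poly Y) : pullPoly f x = pullPoly g x := by rw [h]

lemma mk_pullPoly_comp (f : X ⟶ Y) (g : Y ⟶ Z) (x : Poly Z) :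
    Ideal.Quotient.mk (relIdeal X) (pullPoly (f ≫ g) x) =
      Ideal.Quotient.mk (relIdeal X) (pullPoly f (pullPoly g x)) := by
  have : (Ideal.Quotient.mk (relIdeal X)).comp (pullPoly (f ≫ g)) =
      (Ideal.Quotient.mk (relIdeal X)).comp ((pullPoly f).comp (pullPoly g)) := by
    refine MvPolynomial.ringHom_ext (by simp) fun ⟨i, F⟩ => ?_
    simp only [RingHom.comp_apply, pullPoly_sym]
    exact (mk_iso i ((pullbackComp f g).app F.1)).symm
  exact RingHom.congr_fun this x

lemma mk_pullPoly_id (x : Poly X) :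
    Ideal.Quotient.mk (relIdeal X) (pullPoly (𝟙 X) x) = Ideal.Quotient.mk (relIdeal X) x := by
  have : (Ideal.Quotient.mk (relIdeal X)).comp (pullPoly (𝟙 X)) =
      Ideal.Quotient.mk (relIdeal X) := by
    refine MvPolynomial.ringHom_ext (by simp) fun ⟨i, F⟩ => ?_
    simp only [RingHom.comp_apply, pullPoly_sym]
    exact mk_iso i ((pullbackId X).app F.1)
  exact RingHom.congr_fun this x

lemma pullPoly_comp_mem (f : X ⟶ Y) (g : Y ⟶ Z) (x : Poly Z) :
    pullPoly (f ≫ g) x ∈ relIdeal X ↔ pullPoly f (pullPoly g x) ∈ relIdeal X := by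
  rw [← Ideal.Quotient.eq_zero_iff_mem, mk_pullPoly_comp, Ideal.Quotient.eq_zero_iff_mem]

/-- The kernel of the map from `ℤ[R_X]` to the direct limit of the rings `ℤ[R_P] / I_P` over all
chains of projective bundles `P ⟶ X`: an element vanishes in the limit if and only if its image in
`ℤ[R_P] / I_P` vanishes for some chain `P ⟶ X`. -/
def kerIdeal (X : Scheme.{u}) : Ideal (Poly X) where
  carrier := {x | ∃ (P : Scheme.{u}) (p : P ⟶ X), Tower p ∧ pullPoly p x ∈ relIdeal P}
  zero_mem' := ⟨X, 𝟙 X, .id, by simp⟩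
  add_mem' := by
    rintro x y ⟨P, p, hp, hx⟩ ⟨P', p', hp', hy⟩
    obtain ⟨Q, q', q, e, hq⟩ := hp.exists_isPullback p'
    refine ⟨Q, q ≫ p', hq.trans hp', ?_⟩
    rw [map_add]
    refine add_mem ?_ ?_
    · rw [← e, pullPoly_comp_mem]
      exact pullPoly_mem _ hx
    · rw [pullPoly_comp_mem]
      exact pullPoly_mem _ hy
  smul_mem' := by
    rintro r x ⟨P, p, hp, hx⟩
    exact ⟨P, p, hp, by
      rw [smul_eq_mul, map_mul]
      exact Ideal.mul_mem_left _ _ hx⟩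

lemma relIdeal_le_kerIdeal (X : Scheme.{u}) : relIdeal X ≤ kerIdeal X := fun _ hx =>
  ⟨X, 𝟙 X, .id, pullPoly_mem _ hx⟩

lemma kerIdeal_le_comap (f : X ⟶ Y) : kerIdeal Y ≤ (kerIdeal X).comap (pullPoly f) := by
  rintro x ⟨P, p, hp, hx⟩
  obtain ⟨Q, q', q, e, hq⟩ := hp.exists_isPullback f
  refine ⟨Q, q, hq, ?_⟩
  rw [← pullPoly_comp_mem, ← e, pullPoly_comp_mem]
  exact pullPoly_mem _ hx

/-! The graded ring `B(X)`. -/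

/-- The degree `i` part of `ℤ[R_X]`, where `c_j(F)` has degree `j`. -/
abbrev polyGrading (X : Scheme.{u}) (i : ℕ) : Submodule ℤ (Poly X) :=
  MvPolynomial.weightedHomogeneousSubmodule ℤ (fun s : ℕ × VB X => s.1) i

instance polyGraded (X : Scheme.{u}) : GradedAlgebra (polyGrading X) :=
  MvPolynomial.weightedGradedAlgebra ℤ _

lemma sym_mem (i : ℕ) (F : VB X) : sym i F ∈ polyGrading X i :=
  MvPolynomial.isWeightedHomogeneous_X ℤ (fun s : ℕ × VB X => s.1) (i, F)

lemma pullPoly_mem_grading (f : X ⟶ Y) {i : ℕ} {x : Poly Y} (hx : x ∈ polyGrading Y i) :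
    pullPoly f x ∈ polyGrading X i := by
  refine MvPolynomial.IsWeightedHomogeneous.induction_on
    (motive := fun x _ => pullPoly f x ∈ polyGrading X i) ?_ ?_ ?_ hx
  · rw [map_zero]; exact zero_mem _
  · intro p q _ _ hp hq
    rw [map_add]; exact add_mem hp hq
  · intro d r hr
    have : pullPoly f (MvPolynomial.monomial d r) =
        MvPolynomial.monomial (d.mapDomain fun s : ℕ × VB Y => (s.1, s.2.pull f)) r :=
      MvPolynomial.rename_monomial _ _ _
    rw [this]
    refine MvPolynomial.isWeightedHomogeneous_monomial _ _ _ ?_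
    rw [← hr, Finsupp.weight_apply, Finsupp.weight_apply, Finsupp.sum_mapDomain_index]
    · simp
    · intros; simp [add_mul]

lemma decompose_pullPoly (f : X ⟶ Y) (x : Poly Y) (i : ℕ) :
    (DirectSum.decompose (polyGrading X) (pullPoly f x) i : Poly X) =
      pullPoly f (DirectSum.decompose (polyGrading Y) x i) := by
  induction x using DirectSum.Decomposition.inductionOn (polyGrading Y) with
  | zero => simp
  | @homogeneous j m =>
    have h := pullPoly_mem_grading f m.2
    by_cases hij : j = i
    · subst hij
      rw [DirectSum.decompose_of_mem_same _ h, DirectSum.decompose_of_mem_same _ m.2]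
    · rw [DirectSum.decompose_of_mem_ne _ h hij, DirectSum.decompose_of_mem_ne _ m.2 hij, map_zero]
  | add m m' h h' => simp [DirectSum.decompose_add, h, h']

lemma IsRelation.isHomogeneousElem {x : Poly X} (h : IsRelation x) :
    SetLike.IsHomogeneousElem (polyGrading X) x := by
  cases h with
  | zero F => exact ⟨0, sub_mem (sym_mem 0 F) SetLike.GradedOne.one_mem⟩
  | rank i F _ => exact ⟨i, sym_mem i F⟩
  | whitney i E G F _ =>
    refine ⟨i, sub_mem (sym_mem i G) (sum_mem fun j hj => ?_)⟩
    have hj' := Finset.mem_range.1 hj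
    have := SetLike.GradedMul.mul_mem (sym_mem (i - j) F) (sym_mem j E)
    rwa [Nat.sub_add_cancel (by omega)] at this
  | tensor L L' hL hL' => exact ⟨1, sub_mem (sub_mem (sym_mem 1 _) (sym_mem 1 _)) (sym_mem 1 _)⟩

lemma relIdeal_isHomogeneous (X : Scheme.{u}) : (relIdeal X).IsHomogeneous (polyGrading X) :=
  Ideal.homogeneous_span _ _ fun _ h => IsRelation.isHomogeneousElem h

lemma kerIdeal_isHomogeneous (X : Scheme.{u}) : (kerIdeal X).IsHomogeneous (polyGrading X) := by
  rintro i x ⟨P, p, hp, hx⟩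
  refine ⟨P, p, hp, ?_⟩
  rw [← decompose_pullPoly]
  exact relIdeal_isHomogeneous P i hx

/-- The ring `B(X)`. -/
abbrev BRing (X : Scheme.{u}) := Poly X ⧸ kerIdeal X

/-- The subgroup `B^i(X)` of elements of degree `i`. -/
def bGrading (X : Scheme.{u}) (i : ℕ) : AddSubgroup (BRing X) :=
  (polyGrading X i).toAddSubgroup.map (Ideal.Quotient.mk (kerIdeal X) : Poly X →+ BRing X)

lemma mk_mem_bGrading {i : ℕ} {x : Poly X} (hx : x ∈ polyGrading X i) :
    Ideal.Quotient.mk (kerIdeal X) x ∈ bGrading X i := ⟨x, hx, rfl⟩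

/-- The projection from the degree `i` part of `ℤ[R_X]` to `B^i(X)`. -/
def toBGrading (X : Scheme.{u}) (i : ℕ) : polyGrading X i →+ bGrading X i where
  toFun x := ⟨Ideal.Quotient.mk (kerIdeal X) x, mk_mem_bGrading x.2⟩
  map_zero' := Subtype.ext (map_zero _)
  map_add' _ _ := Subtype.ext (map_add _ _ _)

/-- The decomposition of the elements of `B(X)` into homogeneous components. -/
def bDecompose (X : Scheme.{u}) : BRing X →+ DirectSum ℕ fun i => bGrading X i :=
  QuotientAddGroup.lift (kerIdeal X).toAddSubgroup
    ((DirectSum.map (toBGrading X)).comp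
      (DirectSum.decomposeAddEquiv (polyGrading X)).toAddMonoidHom) (by
    intro x hx
    ext i
    exact Ideal.Quotient.eq_zero_iff_mem.2 (kerIdeal_isHomogeneous X i hx))

lemma bDecompose_mk (x : Poly X) : bDecompose X (Ideal.Quotient.mk (kerIdeal X) x) =
    DirectSum.map (toBGrading X) (DirectSum.decompose (polyGrading X) x) := rfl

lemma coe_bDecompose (X : Scheme.{u}) (x : BRing X) :
    DirectSum.coeAddMonoidHom (bGrading X) (bDecompose X x) = x := by
  obtain ⟨x, rfl⟩ := Ideal.Quotient.mk_surjective x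
  rw [bDecompose_mk]
  induction x using DirectSum.Decomposition.inductionOn (polyGrading X) with
  | zero => simp
  | homogeneous m =>
    rw [DirectSum.decompose_coe, DirectSum.map_of, DirectSum.coeAddMonoidHom_of]
    rfl
  | add m m' h h' => rw [DirectSum.decompose_add, map_add, map_add, h, h', map_add]

lemma bDecompose_coe (X : Scheme.{u}) (i : ℕ) (x : bGrading X i) :
    bDecompose X x = DirectSum.of (fun i => bGrading X i) i x := by
  obtain ⟨_, x, hx, rfl⟩ := x
  change bDecompose X (Ideal.Quotient.mk (kerIdeal X) x) =
    DirectSum.of (fun i => bGrading X i) i (toBGrading X i ⟨x, hx⟩)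
  have hx' : x ∈ polyGrading X i := hx
  rw [bDecompose_mk, DirectSum.decompose_of_mem (polyGrading X) hx', DirectSum.map_of]

instance bGraded (X : Scheme.{u}) : GradedRing (bGrading X) where
  one_mem := mk_mem_bGrading (SetLike.GradedOne.one_mem (A := polyGrading X))
  mul_mem := by
    rintro i j _ _ ⟨x, hx, rfl⟩ ⟨y, hy, rfl⟩
    exact mk_mem_bGrading (SetLike.GradedMul.mul_mem (A := polyGrading X) hx hy)
  toDecomposition := DirectSum.Decomposition.ofAddHom (bGrading X) (bDecompose X)
    (AddMonoidHom.ext fun x => coe_bDecompose X x)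
    (DirectSum.addHom_ext fun i x => by
      simp only [AddMonoidHom.comp_apply, DirectSum.coeAddMonoidHom_of, AddMonoidHom.id_apply]
      exact bDecompose_coe X i x)

/-! Graded rings. -/

/-- Commutative rings with a grading by the natural numbers. -/
structure GrRing : Type (w + 1) where
  carrier : Type w
  [commRing : CommRing carrier]
  grading : ℕ → AddSubgroup carrier
  [gradedRing : GradedRing grading]

attribute [instance] GrRing.commRing GrRing.gradedRing

instance : Category GrRing.{w} where
  Hom R S := R.grading →+*ᵍ S.grading
  id R := GradedRingHom.id R.grading
  comp f g := g.comp f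

/-- The map `f^* : A(Y) ⟶ A(X)` given by a contravariant functor `A`. -/
def pullHom (A : Scheme.{u}ᵒᵖ ⥤ GrRing.{w}) (f : X ⟶ Y) :
    (A.obj (.op Y)).grading →+*ᵍ (A.obj (.op X)).grading := A.map f.op

/-- The map `f^* : B(Y) ⟶ B(X)`. -/
def bPull (f : X ⟶ Y) : bGrading Y →+*ᵍ bGrading X where
  __ := Ideal.quotientMap (kerIdeal X) (pullPoly f) (kerIdeal_le_comap f)
  map_mem := by
    rintro i _ ⟨x, hx, rfl⟩
    exact ⟨pullPoly f x, pullPoly_mem_grading f hx, rfl⟩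

lemma bPull_mk (f : X ⟶ Y) (x : Poly Y) : bPull f (Ideal.Quotient.mk (kerIdeal Y) x) =
    Ideal.Quotient.mk (kerIdeal X) (pullPoly f x) := rfl

lemma mk_ker_eq {x y : Poly X} (h : Ideal.Quotient.mk (relIdeal X) x =
    Ideal.Quotient.mk (relIdeal X) y) :
    Ideal.Quotient.mk (kerIdeal X) x = Ideal.Quotient.mk (kerIdeal X) y :=
  Ideal.Quotient.eq.2 (relIdeal_le_kerIdeal X (Ideal.Quotient.eq.1 h))

/-- The contravariant functor `B` from schemes to graded rings. -/
def B : Scheme.{u}ᵒᵖ ⥤ GrRing.{u + 1} where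
  obj X := { carrier := BRing X.unop, grading := bGrading X.unop }
  map f := bPull f.unop
  map_id X := by
    refine GradedRingHom.ext fun x => ?_
    obtain ⟨x, rfl⟩ := Ideal.Quotient.mk_surjective x
    exact mk_ker_eq (mk_pullPoly_id x)
  map_comp f g := by
    refine GradedRingHom.ext fun x => ?_
    obtain ⟨x, rfl⟩ := Ideal.Quotient.mk_surjective x
    exact mk_ker_eq (mk_pullPoly_comp g.unop f.unop x)

/-- The class `[c_i(F)]` in `B(X)`. -/
def bClass (i : ℕ) (F : VB X) : BRing X := Ideal.Quotient.mk (kerIdeal X) (sym i F)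

lemma bClass_mem (i : ℕ) (F : VB X) : bClass i F ∈ bGrading X i := mk_mem_bGrading (sym_mem i F)

lemma bClass_zero (F : VB X) : bClass 0 F = 1 := by
  simpa [bClass] using mk_ker_eq (y := 1) (mk_zero F)

lemma bClass_whitney (i : ℕ) {E G F : VB X} (h : IsExtension E G F) :
    bClass i G = ∑ j ∈ Finset.range (i + 1), bClass (i - j) F * bClass j E := by
  have := mk_ker_eq (x := sym i G)
    (y := ∑ j ∈ Finset.range (i + 1), sym (i - j) F * sym j E) (by simpa using mk_whitney i h)
  simpa [bClass] using this

/-- The invertible power series `1 + [c_1(F)] t + [c_2(F)] t^2 + ⋯` over `B(X)`. -/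
def totalSeries (F : VB X) : (PowerSeries (BRing X))ˣ :=
  (show IsUnit (PowerSeries.mk fun i => bClass i F) by
    rw [PowerSeries.isUnit_iff_constantCoeff, ← PowerSeries.coeff_zero_eq_constantCoeff_apply,
      PowerSeries.coeff_mk, bClass_zero]
    exact isUnit_one).unit

@[simp] lemma coe_totalSeries (F : VB X) :
    (totalSeries F : PowerSeries (BRing X)) = PowerSeries.mk fun i => bClass i F := rfl

/-- The total Chern class `K(X) ⟶ B(X)[[t]]ˣ`. -/
def totalChern (X : Scheme.{u}) : K X →+ Additive (PowerSeries (BRing X))ˣ :=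
  K.lift (fun F => Additive.ofMul (totalSeries F)) (by
    intro E G F h
    rw [← ofMul_mul]
    refine congrArg _ (Units.ext ?_)
    ext i
    rw [Units.val_mul, mul_comm, coe_totalSeries, coe_totalSeries, coe_totalSeries,
      PowerSeries.coeff_mk, PowerSeries.coeff_mul, bClass_whitney i h,
      ← Finset.Nat.sum_antidiagonal_swap, Finset.Nat.sum_antidiagonal_eq_sum_range_succ_mk]
    simp)

/-- The Chern class `c_i : K(X) ⟶ B(X)`, the coefficient of `t^i` in the total Chern class. -/
def bChern (i : ℕ) (X : Scheme.{u}) (x : K X) : BRing X :=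
  PowerSeries.coeff i ((totalChern X x).toMul : PowerSeries (BRing X))

lemma bChern_of (i : ℕ) (F : VB X) : bChern i X (K.of F) = bClass i F := by
  simp [bChern, totalChern]

lemma coeff_inv_mem {u : (PowerSeries (BRing X))ˣ}
    (h0 : PowerSeries.coeff 0 (u : PowerSeries (BRing X)) = 1)
    (hu : ∀ i, PowerSeries.coeff i (u : PowerSeries (BRing X)) ∈ bGrading X i) (i : ℕ) :
    PowerSeries.coeff i ((u⁻¹ : (PowerSeries (BRing X))ˣ) : PowerSeries (BRing X)) ∈
      bGrading X i := by
  induction i using Nat.strong_induction_on with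
  | _ i ih =>
    have h := congrArg (PowerSeries.coeff i) u.mul_inv
    rw [PowerSeries.coeff_mul, Finset.Nat.sum_antidiagonal_eq_sum_range_succ_mk,
      Finset.sum_range_succ', PowerSeries.coeff_one] at h
    simp only [Nat.sub_zero, h0, one_mul] at h
    rw [eq_sub_of_add_eq' h]
    refine sub_mem ?_ (sum_mem fun j hj => ?_)
    · split_ifs with hi
      · subst hi; exact SetLike.GradedOne.one_mem
      · exact zero_mem _
    · have hj' := Finset.mem_range.1 hj
      have := SetLike.GradedMul.mul_mem (hu (j + 1)) (ih (i - (j + 1)) (by omega))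
      rwa [show j + 1 + (i - (j + 1)) = i by omega] at this

/-- The group of series `1 + a_1 t + a_2 t^2 + ⋯` with `a_i` of degree `i`. -/
def homogeneousSeries (X : Scheme.{u}) : Subgroup (PowerSeries (BRing X))ˣ where
  carrier := {u | PowerSeries.coeff 0 (u : PowerSeries (BRing X)) = 1 ∧
    ∀ i, PowerSeries.coeff i (u : PowerSeries (BRing X)) ∈ bGrading X i}
  one_mem' := ⟨by simp, fun i => by
    rw [Units.val_one, PowerSeries.coeff_one]
    split_ifs with hi
    · subst hi; exact SetLike.GradedOne.one_mem
    · exact zero_mem _⟩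
  mul_mem' := by
    rintro a b ⟨ha, ha'⟩ ⟨hb, hb'⟩
    refine ⟨by
      rw [Units.val_mul, PowerSeries.coeff_mul, Finset.Nat.antidiagonal_zero,
        Finset.sum_singleton, ha, hb, one_mul], fun i => ?_⟩
    rw [Units.val_mul, PowerSeries.coeff_mul]
    refine sum_mem fun p hp => ?_
    have := SetLike.GradedMul.mul_mem (ha' p.1) (hb' p.2)
    rwa [Finset.HasAntidiagonal.mem_antidiagonal.1 hp] at this
  inv_mem' := by
    rintro a ⟨ha, ha'⟩
    refine ⟨?_, coeff_inv_mem ha ha'⟩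
    have h := congrArg (PowerSeries.coeff 0) a.mul_inv
    rwa [PowerSeries.coeff_mul, Finset.Nat.antidiagonal_zero, Finset.sum_singleton, ha,
      one_mul, PowerSeries.coeff_one, if_pos rfl] at h

lemma bChern_mem (i : ℕ) (X : Scheme.{u}) (x : K X) : bChern i X x ∈ bGrading X i := by
  suffices h : (totalChern X x).toMul ∈ homogeneousSeries X from h.2 i
  obtain ⟨x, rfl⟩ := QuotientAddGroup.mk_surjective x
  induction x using FreeAbelianGroup.induction_on with
  | zero => exact one_mem _
  | of F =>
    change (totalChern X (K.of F)).toMul ∈ _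
    simp only [totalChern, K.lift_of, toMul_ofMul]
    exact ⟨by simp [bClass_zero], fun i => by simpa using bClass_mem i F⟩
  | neg F h => 
    rw [QuotientAddGroup.mk_neg, map_neg, toMul_neg]
    exact inv_mem h
  | add x y h h' =>
    rw [QuotientAddGroup.mk_add, map_add, toMul_add]
    exact mul_mem h h'

lemma bChern_pull (i : ℕ) (f : X ⟶ Y) (x : K Y) :
    bChern i X (K.pull f x) = bPull f (bChern i Y x) := by
  let m : Additive (PowerSeries (BRing Y))ˣ →+ Additive (PowerSeries (BRing X))ˣ :=
    (Units.map (PowerSeries.map (bPull f).toRingHom).toMonoidHom).toAdditive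
  have : (totalChern X).comp (K.pull f) = m.comp (totalChern Y) := by
    refine K.hom_ext (A := Additive (PowerSeries (BRing X))ˣ) fun F => ?_
    simp only [AddMonoidHom.comp_apply, K.pull_of, totalChern, K.lift_of]
    refine congrArg Additive.ofMul (Units.ext ?_)
    ext i
    change PowerSeries.coeff i (totalSeries (F.pull f) : PowerSeries (BRing X)) =
      PowerSeries.coeff i (PowerSeries.map (bPull f).toRingHom
        (totalSeries F : PowerSeries (BRing Y)))
    rw [PowerSeries.coeff_map, coe_totalSeries, coe_totalSeries, PowerSeries.coeff_mk,
      PowerSeries.coeff_mk]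
    refine Eq.trans ?_ (bPull_mk f (sym i F)).symm
    rw [pullPoly_sym]
    rfl
  have h := DFunLike.congr_fun this x
  have h' := congrArg (fun u : Additive (PowerSeries (BRing X))ˣ =>
    PowerSeries.coeff i (u.toMul : PowerSeries (BRing X))) h
  refine h'.trans ?_
  change PowerSeries.coeff i (PowerSeries.map (bPull f).toRingHom _) = _
  rw [PowerSeries.coeff_map]
  rfl

/-- Natural transformations `c_i : K ⟶ A^i` of functors from schemes to sets, for `i ≥ 0`. -/
structure ChernClasses (A : Scheme.{u}ᵒᵖ ⥤ GrRing.{w}) where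
  c (i : ℕ) (X : Scheme.{u}) : K X → (A.obj (.op X)).carrier
  mem (i : ℕ) (X : Scheme.{u}) (x : K X) : c i X x ∈ (A.obj (.op X)).grading i
  natural (i : ℕ) {X Y : Scheme.{u}} (f : X ⟶ Y) (y : K Y) :
    c i X (K.pull f y) = pullHom A f (c i Y y)

/-- The properties required of a theory of Chern classes with values in `A`: normalization,
vanishing above the rank, the Whitney sum formula, additivity of `c_1` on tensor products of
invertible sheaves, and injectivity of `A(X) ⟶ A(P(E))` for every projective bundle `P(E) ⟶ X`. -/
structure ChernClasses.IsTheory {A : Scheme.{u}ᵒᵖ ⥤ GrRing.{w}} (C : ChernClasses A) : Prop where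
  normalization (X : Scheme.{u}) (F : VB X) : C.c 0 X (K.of F) = 1
  vanishing (X : Scheme.{u}) (i : ℕ) (F : VB X) (h : RankLT F i) : C.c i X (K.of F) = 0
  whitney (X : Scheme.{u}) (i : ℕ) (E G F : VB X) (h : IsExtension E G F) :
    C.c i X (K.of G) = ∑ j ∈ Finset.range (i + 1), C.c (i - j) X (K.of F) * C.c j X (K.of E)
  additivity (X : Scheme.{u}) (L L' : VB X) (hL : IsInvertible L.1) (hL' : IsInvertible L'.1) :
    C.c 1 X (K.of (tensorVB hL hL')) = C.c 1 X (K.of L) + C.c 1 X (K.of L')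
  injective {X P : Scheme.{u}} (E : X.Modules) (hE : IsLocallyFreePositive E) (p : P ⟶ X)
    (hp : IsProjectiveBundle E p) : Function.Injective (pullHom A p)

/-- The Chern classes `c_i : K ⟶ B^i`. -/
def universalChern : ChernClasses B.{u} where
  c := bChern
  mem := bChern_mem
  natural i _ _ f y := bChern_pull i f y

/-- Natural transformations between contravariant functors from schemes to graded rings. -/
@[ext] structure GrTrans (A : Scheme.{u}ᵒᵖ ⥤ GrRing.{w}) (A' : Scheme.{u}ᵒᵖ ⥤ GrRing.{w'}) where
  app (X : Scheme.{u}) : (A.obj (.op X)).grading →+*ᵍ (A'.obj (.op X)).grading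
  naturality {X Y : Scheme.{u}} (f : X ⟶ Y) (y : (A.obj (.op Y)).carrier) :
    app X (pullHom A f y) = pullHom A' f (app Y y)

end

end ChernUniversal

/-!
A theory of Chern classes `C` on `A` determines, for each scheme `X`, a ring homomorphism
`C.eval X : ℤ[R_X] ⟶ A(X)` sending the symbol `c_i(F)` to `C.c i X [F]`. It respects degrees
(`eval_mem_grading`), commutes with pullbacks (`eval_pullPoly`), and kills `I_X`, because the
generators of `I_X` are exactly the first four axioms of a theory (`eval_eq_zero_of_mem_relIdeal`).
If `x` lies in `J_X`, then `p^* x ∈ I_P` for some chain of projective bundles `p : P ⟶ X`, so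
`p^*` of the value of `x` vanishes in `A(P)`; the pullback `A(X) ⟶ A(P)` is injective, being a
composition of the injections along the successive projective bundles (`pullHom_injective`), so
the value of `x` is already zero in `A(X)`. Hence the evaluation factors through
`B(X) = ℤ[R_X] / J_X`. Uniqueness holds because the classes `[c_i(F)]` generate the ring `B(X)`.
-/

namespace ChernUniversal

lemma pullHom_id (A : Scheme.{u}ᵒᵖ ⥤ GrRing.{w}) (X : Scheme.{u}) (a : (A.obj (.op X)).carrier) :
    pullHom A (𝟙 X) a = a :=
  GradedRingHom.congr_fun (A.map_id (.op X)) a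

lemma pullHom_comp (A : Scheme.{u}ᵒᵖ ⥤ GrRing.{w}) {X Y Z : Scheme.{u}} (f : X ⟶ Y) (g : Y ⟶ Z)
    (a : (A.obj (.op Z)).carrier) : pullHom A (f ≫ g) a = pullHom A f (pullHom A g a) :=
  GradedRingHom.congr_fun (A.map_comp g.op f.op) a

namespace ChernClasses

variable {A : Scheme.{u}ᵒᵖ ⥤ GrRing.{w}} (C : ChernClasses A)

/-- The ring homomorphism `ℤ[R_X] ⟶ A(X)` sending the symbol `c_i(F)` to the `i`-th Chern class
of `F` with values in `A`. -/
noncomputable def eval (X : Scheme.{u}) : Poly X →+* (A.obj (.op X)).carrier :=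
  MvPolynomial.eval₂Hom (Int.castRingHom _) fun s => C.c s.1 X (K.of s.2)

@[simp] lemma eval_sym {X : Scheme.{u}} (i : ℕ) (F : VB X) :
    C.eval X (sym i F) = C.c i X (K.of F) :=
  MvPolynomial.eval₂Hom_X' _ _ _

lemma eval_pullPoly {X Y : Scheme.{u}} (f : X ⟶ Y) (x : Poly Y) :
    C.eval X (pullPoly f x) = pullHom A f (C.eval Y x) := by
  have h : (C.eval X).comp (pullPoly f) = (pullHom A f).toRingHom.comp (C.eval Y) := by
    refine MvPolynomial.ringHom_ext (fun n => by simp) fun ⟨i, F⟩ => ?_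
    simp only [RingHom.comp_apply, pullPoly_sym, eval_sym, GradedRingHom.coe_toRingHom]
    rw [← C.natural, K.pull_of]
  exact DFunLike.congr_fun h x

lemma eval_mem_grading {X : Scheme.{u}} {i : ℕ} {x : Poly X} (hx : x ∈ polyGrading X i) :
    C.eval X x ∈ (A.obj (.op X)).grading i := by
  refine MvPolynomial.IsWeightedHomogeneous.induction_on
    (motive := fun x _ => C.eval X x ∈ (A.obj (.op X)).grading i) ?_ ?_ ?_ hx
  · rw [map_zero]; exact zero_mem _
  · intro p q _ _ hp hq
    rw [map_add]; exact add_mem hp hq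
  · intro d r hd
    rw [eval, MvPolynomial.eval₂Hom_monomial, ← hd, Finsupp.weight_apply]
    -- The integer coefficient acts additively, so only the monomial carries a degree.
    rw [eq_intCast, ← zsmul_eq_mul]
    refine zsmul_mem (SetLike.prod_pow_mem_graded (A.obj (.op X)).grading _ _ _
      fun s _ => C.mem s.1 X (K.of s.2)) r

namespace IsTheory

variable {C} (hC : C.IsTheory)
include hC

lemma eval_eq_zero_of_mem_relIdeal {X : Scheme.{u}} {x : Poly X} (hx : x ∈ relIdeal X) :
    C.eval X x = 0 := by
  suffices h : relIdeal X ≤ RingHom.ker (C.eval X) from h hx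
  refine Ideal.span_le.2 fun y hy => ?_
  rw [SetLike.mem_coe, RingHom.mem_ker]
  cases hy with
  | zero F => rw [map_sub, map_one, eval_sym, hC.normalization, sub_self]
  | rank i F h => rw [eval_sym, hC.vanishing X i F h]
  | whitney i E G F h =>
    simp only [map_sub, map_sum, map_mul, eval_sym]
    rw [hC.whitney X i E G F h, sub_self]
  | tensor L L' hL hL' =>
    simp only [map_sub, eval_sym]
    rw [hC.additivity X L L' hL hL', add_sub_cancel_left, sub_self]

lemma pullHom_injective {P X : Scheme.{u}} {p : P ⟶ X} (hp : Tower p) :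
    Function.Injective (pullHom A p) := by
  induction hp with
  | id => exact fun a b h => by simpa only [pullHom_id] using h
  | comp q p E hE hp _ ih =>
    intro a b h
    rw [pullHom_comp, pullHom_comp] at h
    exact hC.injective E hE p hp (ih h)

lemma eval_eq_zero_of_mem_kerIdeal {X : Scheme.{u}} {x : Poly X} (hx : x ∈ kerIdeal X) :
    C.eval X x = 0 := by
  obtain ⟨P, p, hp, hx⟩ := hx
  apply hC.pullHom_injective hp
  rw [← C.eval_pullPoly, hC.eval_eq_zero_of_mem_relIdeal hx, map_zero]

/-- The natural transformation `B ⟶ A` induced by a theory of Chern classes with values in `A`. -/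
noncomputable def trans : GrTrans B.{u} A where
  app X :=
    { __ := Ideal.Quotient.lift (kerIdeal X) (C.eval X) fun _ => hC.eval_eq_zero_of_mem_kerIdeal
      map_mem := by
        rintro i _ ⟨x, hx, rfl⟩
        exact C.eval_mem_grading hx }
  naturality {X Y} f y := by
    obtain ⟨y, rfl⟩ := Ideal.Quotient.mk_surjective y
    exact C.eval_pullPoly f y

lemma trans_bClass {X : Scheme.{u}} (i : ℕ) (F : VB X) :
    hC.trans.app X (bClass i F) = C.c i X (K.of F) :=
  C.eval_sym i F

end IsTheory

end ChernClasses

/-- The classes `[c_i(F)]` generate `B(X)` as a ring, so they determine a natural transformation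
out of `B`. -/
lemma GrTrans.ext_bClass {A : Scheme.{u}ᵒᵖ ⥤ GrRing.{w}} {b b' : GrTrans B.{u} A}
    (h : ∀ (X : Scheme.{u}) (i : ℕ) (F : VB X),
      b.app X (bClass i F) = b'.app X (bClass i F)) : b = b' := by
  refine GrTrans.ext (funext fun X => GradedRingHom.coe_ringHom_injective ?_)
  refine Ideal.Quotient.ringHom_ext (MvPolynomial.ringHom_ext (fun n => by simp) fun ⟨i, F⟩ => ?_)
  exact h X i F

end ChernUniversal

theorem proposition2p1 (A : Scheme.{u}ᵒᵖ ⥤ ChernUniversal.GrRing.{w})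
    (C : ChernUniversal.ChernClasses A) (hC : C.IsTheory) :
    ∃! b : ChernUniversal.GrTrans ChernUniversal.B A,
      ∀ (X : Scheme.{u}) (i : ℕ) (F : ChernUniversal.VB X),
        b.app X (ChernUniversal.universalChern.c i X (ChernUniversal.K.of F)) =
          C.c i X (ChernUniversal.K.of F) := by
  refine ⟨hC.trans, fun X i F => ?_, fun b hb => ?_⟩
  · exact (congrArg _ (ChernUniversal.bChern_of i F)).trans (hC.trans_bClass i F)
  · refine ChernUniversal.GrTrans.ext_bClass fun X i F => ?_
    rw [hC.trans_bClass, ← hb X i F]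
    exact congrArg _ (ChernUniversal.bChern_of i F).symm
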